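/- **Model.** A continuum of players, modelled by a probability space $(\Omega,P)$, repeatedly shares two resources $1,2$. Players have weights $W\in[w_{\min},w_{\max}]$, $w_{\min}>0$. At each time $t\ge 0$ a player participates with probability $P_{\rm go}\in(0,1]$ and has an urgency $U_t\ge 0$ with finite mean and continuous distribution function; participations and urgencies are mutually independent, i.i.d. in time, and independent of $(W,K_0)$, where $K_0\ge 0$ is the initial artificial-currency level. The latencies $l_1,l_2:[0,P_{\rm go}]\to\mathbb R_{\ge0}$ are continuous and nondecreasing. A decision outcome $A_t\in\{0,1,2\}$ ($0$ exactly for non-participants) has aggregate $w^{A_t}_r=\mathbb E[W\mathbf 1_{\{A_t=r\}}]/\mathbb E[W]$. With prices $p(W)=(p_1(W),p_2(W))$, the levels evolve as $K_{t+1}=K_t-p_{A_t}(W)$ (no payment if $A_t=0$). Given $l_r=l_r(w_r^{A_t})$, a participating player with level $k$ and urgency $u$ minimizes over $r\in\{1,2\}$ and $y\in[0,1]$ the cost $u\,l_r+TP_{\rm go}\mathbb E[U]\,(y\,l_1+(1-y)l_2)$ subject to $p_r\le k$ and $p_r+TP_{\rm go}(y\,p_1+(1-y)p_2)\le k$, where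 $T\in\mathbb N$ is a fixed horizon. $A_t$ is a Nash equilibrium (NE) if it is measurable and almost every participating player chooses an $r$ that is part of a minimizer. Let $C(w)=w_1l_1(w_1)+w_2l_2(w_2)$ satisfy $|C(w)-C(w')|\le L_C(|w_1-w_1'|+|w_2-w_2'|)$ on $[0,P_{\rm go}]^2$ with $L_C>0$; let $w^\star$ minimize $C$ over $\{w\ge0: w_1+w_2=P_{\rm go}\}$, write $l_r^\star=l_r(w_r^\star)$, and assume $C(w^\star)>0$ and $l_1^\star<l_2^\star$. Put $$\mathrm{PoA}_t=\frac{C(w^{A_t})}{C(w^\star)},\qquad \mathrm{InEql}_t=\sqrt{\mathrm{Var}[L_t/W]},$$ where $L_t$ is the average of the latencies $l_{A_\tau}(w^{A_\tau}_{A_\tau})$ that the player perceived over the participations at times $\tau\le t$ (and $0$ if there are none). **Prices.** Let $\xi=P_{\rm go}l_2^\star/(l_2^\star-l_1^\star)$, let $n_1(w,\theta)$ be $w_1^\star+(\xi-w_1^\star)(1-w/\theta)$ saturated to $[0,P_{\rm go}]$, and let $n_2=P_{\rm go}-n_1$. Let $\theta^\star>0$ solve the design equation $w_1^\star\,\mathbb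 E[W]=\mathbb E[n_1(W,\theta^\star)W]$. The optimal (design) inequality is that of the latency prescribed by $\theta^\star$: $$\mathrm{InEql}^\star=\sqrt{\mathrm{Var}[L^\star/W]},\qquad L^\star=\frac{n_1(W,\theta^\star)l_1^\star+n_2(W,\theta^\star)l_2^\star}{P_{\rm go}}.$$ For $\delta>0$ let $\mathrm{rat}_\delta=\sum_{j\ge1}q_j\mathbf 1_{((j-1)\delta,j\delta]}$, where the $q_j$ are any positive rationals with $|q_j-x|<\delta$ for all $x\in((j-1)\delta,j\delta]$. With $S>0$, and $n_r=n_r(w,\theta^\star)$, the prices for weight $w$ are $$p(w)=\begin{cases}S\,\bigl(\mathrm{rat}_\delta(n_2/n_1),\,-1\bigr), & n_2/n_1\le w_2^\star/w_1^\star,\\ S\,\mathrm{rat}_\delta(w_2^\star/w_1^\star)\,\bigl(1,\,-\mathrm{rat}_\delta(n_1/n_2)\bigr), & \text{otherwise.}\end{cases}$$ **Theorem.** There is $\varepsilon_0>0$ such that for every $\varepsilon\in(0,\varepsilon_0)$ the following holds for the prices with $\delta=\varepsilon P_{\rm go}C(w^\star)/L_C$ (and any $S$ and any admissible $q_j$).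 There is a joint law of $(W,K_0)$, with $K_0\ge0$ and the given law of $W$, such that in every population with this initial law there is a sequence of NE $(A_t)_{t\ge0}$ with $l_1(w_1^{A_t})<l_2(w_2^{A_t})$ for all $t$, and for every such sequence the following limits exist and satisfy $$\lim_{t\to\infty}\mathrm{PoA}_t\le1+\varepsilon,\qquad \Bigl|\lim_{t\to\infty}\mathrm{InEql}_t-\mathrm{InEql}^\star\Bigr|<\sqrt{D\varepsilon},$$ where $D=(D_1+D_2)P_{\rm go}C(w^\star)/L_C$ with $$D_1=\frac{2l_2^\star(l_2^\star-l_1^\star)\,\mathbb E[1/W]}{P_{\rm go}^3\,w_{\min}},\qquad D_2=\frac{2(l_2^\star-l_1^\star)(2l_2^\star-l_1^\star)\,\mathbb E[1/W^2]}{P_{\rm go}^2}.$$ -/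

import Mathlib

open MeasureTheory ProbabilityTheory Filter Topology

noncomputable section

/-- A repeated weighted congestion game with two resources and a continuum of players.
Resource `{1}` is the index `0 : Fin 2` and resource `{2}` is the index `1 : Fin 2`.
`weightLaw` is the law of the weight of a player, `urgencyLaw` the law of the urgency of a player
at a given time (its distribution function is continuous), `Pgo` the probability that a player
participates at a given time, and `T` the planning horizon of the players. -/
structure CongestionGame where
  l : Fin 2 → ℝ → ℝ
  weightLaw : Measure ℝ
  urgencyLaw : Measure ℝ
  wmin : ℝ
  wmax : ℝ
  Pgo : ℝ
  T : ℕ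
  Pgo_pos : 0 < Pgo
  Pgo_le_one : Pgo ≤ 1
  l_continuous : ∀ r, ContinuousOn (l r) (Set.Icc 0 Pgo)
  l_monotone : ∀ r, MonotoneOn (l r) (Set.Icc 0 Pgo)
  l_nonneg : ∀ r, ∀ x ∈ Set.Icc 0 Pgo, 0 ≤ l r x
  weight_prob : IsProbabilityMeasure weightLaw
  wmin_pos : 0 < wmin
  weight_mem : ∀ᵐ w ∂weightLaw, w ∈ Set.Icc wmin wmax
  urgency_prob : IsProbabilityMeasure urgencyLaw
  urgency_noAtoms : NullSingletonClass urgencyLaw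
  urgency_nonneg : ∀ᵐ u ∂urgencyLaw, 0 ≤ u
  urgency_integrable : Integrable (fun u : ℝ => u) urgencyLaw

namespace CongestionGame

variable (G : CongestionGame)

/-! ### Societal cost and its optimum -/

/-- The possible aggregates: how the cumulative weight is split between the two resources. -/
def aggregates : Set (Fin 2 → ℝ) := {w | (∀ r, 0 ≤ w r) ∧ ∑ r, w r = G.Pgo}

/-- The societal cost `C(w) = wᵀ l(w)`. -/
def cost (w : Fin 2 → ℝ) : ℝ := ∑ r, w r * G.l r (w r)

/-- `w` is a system optimum: it minimizes the societal cost. -/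
def IsOptimum (w : Fin 2 → ℝ) : Prop := w ∈ G.aggregates ∧ IsMinOn G.cost G.aggregates w

/-- The societal cost is Lipschitz continuous with constant `LC`. The `ℓ¹` norm is used, so that
this is implied by Lipschitz continuity with the same constant in any `ℓᵖ` norm. -/
def CostLipschitz (LC : ℝ) : Prop :=
  ∀ w w' : Fin 2 → ℝ, (∀ r, w r ∈ Set.Icc 0 G.Pgo) → (∀ r, w' r ∈ Set.Icc 0 G.Pgo) →
    |G.cost w - G.cost w'| ≤ LC * ∑ r, |w r - w' r|

/-! ### Decision problem of a player -/

/-- A player with currency level `k` who faces the prices `p` can afford to choose `r` now and to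
split the (on average `T * Pgo`) participations in the planning horizon as `(y, 1 - y)`. -/
def Feasible (p : Fin 2 → ℝ) (k : ℝ) (r : Fin 2) (y : ℝ) : Prop :=
  y ∈ Set.Icc 0 1 ∧ p r ≤ k ∧ p r + G.T * G.Pgo * (y * p 0 + (1 - y) * p 1) ≤ k

/-- Cost of a plan `(r, y)`: the urgency-weighted latency now, plus the predicted latency over the
planning horizon, weighted by the mean urgency. -/
def planCost (lat : Fin 2 → ℝ) (u : ℝ) (r : Fin 2) (y : ℝ) : ℝ :=
  u * lat r + G.T * G.Pgo * (∫ v, v ∂G.urgencyLaw) * (y * lat 0 + (1 - y) * lat 1)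

/-- Resource `r` is a best response: it is the present choice of an optimal plan. -/
def IsBestResponse (lat p : Fin 2 → ℝ) (k u : ℝ) (r : Fin 2) : Prop :=
  ∃ y, G.Feasible p k r y ∧
    ∀ r' y', G.Feasible p k r' y' → G.planCost lat u r y ≤ G.planCost lat u r' y'

/-! ### Decision outcomes, equilibria, and their evolution

The population is a probability space `(Ω, μ)`. A decision outcome is a map
`a : Ω → Option (Fin 2)`, with `none` for the players who do not participate. -/

/-- Proportion of the cumulative weight of the players who choose `r`. -/
def agg {Ω : Type*} [MeasurableSpace Ω] (μ : Measure Ω) (W : Ω → ℝ)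
    (a : Ω → Option (Fin 2)) (r : Fin 2) : ℝ :=
  (∫ ω in {ω | a ω = some r}, W ω ∂μ) / ∫ ω, W ω ∂μ

/-- `a` is a Nash equilibrium at one time instant, given the pricing policy `p` (prices as a function
of the weight), the currency levels `K`, the participation `P` and the urgencies `U`: almost every
participating player plays a best response to the latencies caused by `a`. -/
def IsNash {Ω : Type*} [MeasurableSpace Ω] (μ : Measure Ω) (p : ℝ → Fin 2 → ℝ) (W K : Ω → ℝ)
    (P : Ω → Bool) (U : Ω → ℝ) (a : Ω → Option (Fin 2)) : Prop :=
  (∀ r, MeasurableSet {ω | a ω = some r}) ∧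
  ∀ᵐ ω ∂μ, (P ω = false → a ω = none) ∧
    (P ω = true → ∃ r, a ω = some r ∧
      G.IsBestResponse (fun s => G.l s (agg μ W a s)) (p (W ω)) (K ω) (U ω) r)

/-- Artificial currency levels along a sequence of decision outcomes: a player who chooses `r`
pays the price of `r` for the weight of that player. -/
def acLevel {Ω : Type*} (p : ℝ → Fin 2 → ℝ) (W K₀ : Ω → ℝ) (A : ℕ → Ω → Option (Fin 2)) :
    ℕ → Ω → ℝ
  | 0, ω => K₀ ω
  | t + 1, ω => acLevel p W K₀ A t ω - (A t ω).elim 0 (p (W ω))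

/-- The decision outcome is a Nash equilibrium at every time. -/
def IsNashTrajectory {Ω : Type*} [MeasurableSpace Ω] (μ : Measure Ω) (p : ℝ → Fin 2 → ℝ)
    (W K₀ : Ω → ℝ) (P : ℕ → Ω → Bool) (U : ℕ → Ω → ℝ) (A : ℕ → Ω → Option (Fin 2)) : Prop :=
  ∀ t, G.IsNash μ p W (acLevel p W K₀ A t) (P t) (U t) (A t)

/-- At every time resource `{1}` is strictly faster than resource `{2}`. -/
def FirstFaster {Ω : Type*} [MeasurableSpace Ω] (μ : Measure Ω) (W : Ω → ℝ)
    (A : ℕ → Ω → Option (Fin 2)) : Prop :=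
  ∀ t, G.l 0 (agg μ W (A t) 0) < G.l 1 (agg μ W (A t) 1)

/-- The weights, initial currency levels, participations and urgencies of the population `(Ω, μ)`
follow the game: weight and initial currency level have joint law `init`; the pairs of
participation and urgency are independent and identically distributed in time, independent of
weight and initial currency level; participation and urgency are independent. -/
structure IsPopulation {Ω : Type*} [MeasurableSpace Ω] (μ : Measure Ω) (init : Measure (ℝ × ℝ))
    (W K₀ : Ω → ℝ) (P : ℕ → Ω → Bool) (U : ℕ → Ω → ℝ) : Prop where
  measurable_W : Measurable W
  measurable_K₀ : Measurable K₀
  measurable_P : ∀ t, Measurable (P t)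
  measurable_U : ∀ t, Measurable (U t)
  law_init : μ.map (fun ω => (W ω, K₀ ω)) = init
  law_P : ∀ t, μ {ω | P t ω = true} = ENNReal.ofReal G.Pgo
  law_U : ∀ t, μ.map (U t) = G.urgencyLaw
  indep_time : iIndepFun (fun t ω => (P t ω, U t ω)) μ
  indep_init : IndepFun (fun ω => (W ω, K₀ ω)) (fun ω t => (P t ω, U t ω)) μ
  indep_PU : ∀ t, IndepFun (P t) (U t) μ

/-! ### Performance metrics -/

/-- Price of anarchy at time `t`. -/
def poa {Ω : Type*} [MeasurableSpace Ω] (μ : Measure Ω) (W : Ω → ℝ) (wstar : Fin 2 → ℝ)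
    (A : ℕ → Ω → Option (Fin 2)) (t : ℕ) : ℝ :=
  G.cost (agg μ W (A t)) / G.cost wstar

/-- Number of participations up to time `t`. -/
def numPart {Ω : Type*} (A : ℕ → Ω → Option (Fin 2)) (t : ℕ) (ω : Ω) : ℝ :=
  ∑ τ ∈ Finset.range (t + 1), (A τ ω).elim 0 (fun _ => (1 : ℝ))

/-- Average latency perceived by a player over the participations up to time `t` (it is `0` if the
player has not participated yet). -/
def avgLatency {Ω : Type*} [MeasurableSpace Ω] (μ : Measure Ω) (W : Ω → ℝ)
    (A : ℕ → Ω → Option (Fin 2)) (t : ℕ) (ω : Ω) : ℝ :=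
  (∑ τ ∈ Finset.range (t + 1), (A τ ω).elim 0 (fun r => G.l r (agg μ W (A τ) r))) /
    numPart A t ω

/-- Inequality at time `t`: standard deviation of the average perceived latency per unit weight. -/
def ineql {Ω : Type*} [MeasurableSpace Ω] (μ : Measure Ω) (W : Ω → ℝ)
    (A : ℕ → Ω → Option (Fin 2)) (t : ℕ) : ℝ :=
  Real.sqrt (variance (fun ω => G.avgLatency μ W A t ω / W ω) μ)

/-! ### Design of the prices -/

/-- `ξ = Pgo l₂⋆ / (l₂⋆ - l₁⋆)` with `l_r⋆ = l_r(w_r⋆)`. -/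
def xi (wstar : Fin 2 → ℝ) : ℝ :=
  G.Pgo * G.l 1 (wstar 1) / (G.l 1 (wstar 1) - G.l 0 (wstar 0))

/-- `n₁(w, θ)`: the affine function `w₁⋆ + (ξ - w₁⋆) (1 - w / θ)` of the weight `w`, saturated to
`[0, Pgo]`. -/
def n₁ (wstar : Fin 2 → ℝ) (θ w : ℝ) : ℝ :=
  max 0 (min G.Pgo (wstar 0 + (G.xi wstar - wstar 0) * (1 - w / θ)))

/-- `n₂(w, θ) = Pgo - n₁(w, θ)`. -/
def n₂ (wstar : Fin 2 → ℝ) (θ w : ℝ) : ℝ := G.Pgo - G.n₁ wstar θ w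

/-- `θ` solves the design equation `w₁⋆ 𝔼[W] = 𝔼[n₁(W, θ) W]`. -/
def IsDesignSolution (wstar : Fin 2 → ℝ) (θ : ℝ) : Prop :=
  0 < θ ∧ wstar 0 * ∫ w, w ∂G.weightLaw = ∫ w, G.n₁ wstar θ w * w ∂G.weightLaw

/-- Average perceived latency `L⋆` prescribed by `n₁(·, θ)` for a player of weight `w`. -/
def designLatency (wstar : Fin 2 → ℝ) (θ w : ℝ) : ℝ :=
  (G.n₁ wstar θ w * G.l 0 (wstar 0) + G.n₂ wstar θ w * G.l 1 (wstar 1)) / G.Pgo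

/-- The inequality `InEql⋆` achieved by `L⋆`. -/
def designIneql (wstar : Fin 2 → ℝ) (θ : ℝ) : ℝ :=
  Real.sqrt (variance (fun w => G.designLatency wstar θ w / w) G.weightLaw)

/-- Admissible values for the rational approximation of step `δ`: `q j` is a positive rational
within `δ` of every point of `(j δ, (j + 1) δ]`. -/
def IsRatSeq (δ : ℝ) (q : ℕ → ℚ) : Prop :=
  ∀ j, 0 < q j ∧ ∀ x ∈ Set.Ioc (j * δ) ((j + 1) * δ), |(q j : ℝ) - x| < δ

/-- The rational approximation function `rat_δ`. -/
def rat (δ : ℝ) (q : ℕ → ℚ) (x : ℝ) : ℝ :=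
  ∑' j : ℕ, (Set.Ioc (j * δ) ((j + 1) * δ)).indicator (fun _ => (q j : ℝ)) x

/-- The weight-dependent prices. The first case is the one of `n₂ / n₁ ≤ w₂⋆ / w₁⋆`, written
without division. -/
def prices (wstar : Fin 2 → ℝ) (θ δ S : ℝ) (q : ℕ → ℚ) (w : ℝ) : Fin 2 → ℝ :=
  open Classical in
  if wstar 0 ≤ G.n₁ wstar θ w then
    ![S * rat δ q (G.n₂ wstar θ w / G.n₁ wstar θ w), -S]
  else
    ![S * rat δ q (wstar 1 / wstar 0),
      -(S * rat δ q (wstar 1 / wstar 0) * rat δ q (G.n₁ wstar θ w / G.n₂ wstar θ w))]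

/-- The step of the rational approximation that belongs to the tolerance `ε`. -/
def step (wstar : Fin 2 → ℝ) (LC ε : ℝ) : ℝ := ε * G.Pgo * G.cost wstar / LC

def D₁ (wstar : Fin 2 → ℝ) : ℝ :=
  2 * G.l 1 (wstar 1) * (G.l 1 (wstar 1) - G.l 0 (wstar 0)) * (∫ w, 1 / w ∂G.weightLaw) /
    (G.Pgo ^ 3 * G.wmin)

def D₂ (wstar : Fin 2 → ℝ) : ℝ :=
  2 * (G.l 1 (wstar 1) - G.l 0 (wstar 0)) * (2 * G.l 1 (wstar 1) - G.l 0 (wstar 0)) *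
    (∫ w, 1 / w ^ 2 ∂G.weightLaw) / G.Pgo ^ 2

/-- The constant `D = (D₁ + D₂) Pgo C(w⋆) / L_C`. -/
def D (wstar : Fin 2 → ℝ) (LC : ℝ) : ℝ := (G.D₁ wstar + G.D₂ wstar) * G.Pgo * G.cost wstar / LC

end CongestionGame

end

/-!
While resource `0` is the faster one, both sides of the trade-off of a player (resource `0` now, or
more often later) are proportional to the gap between the two latencies. Hence the best response
depends only on the prices, the level and the urgency: resource `0` is chosen if it is affordable
and the urgency exceeds a threshold (`isBestResponse_iff_eq_decision`). Ties have probability zero,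
so the equilibria with resource `0` faster are unique up to null sets, and under them the level of
each player is an autonomous Markov chain.

The rational approximation puts the prices of a given weight on a lattice. Rich players always take
resource `0`, so the chain lives on a finite set and has a stationary law
(`exists_stationary_level`). The prices take countably many values, so the stationary laws form a
kernel, and composing it with the law of the weights gives the initial law. Then weights and levels
have the same joint law at all times, and the aggregates are constant.

The levels are bounded, so payments balance: a player facing prices `p` takes resource `0` in a
share `-p₁ / (p₀ - p₁)` of the participations, in mean at every time (`stationary_rate`) and
pathwise in the long run (`ae_tendsto_avgLatency`). By the choice of the prices, `Pgo` times this
share is within `Pgo * δ` of the design `n₁`. So the aggregate is within `Pgo * δ` of the optimum,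
and since the cost of only one of the two resources exceeds its optimal value, the Lipschitz bound
gives the price of anarchy (`CostLipschitz.cost_le`). The Lipschitz bound on the cost also makes the
latencies Lipschitz at the resources used by the optimum. Therefore the limit of the inequality
differs from its design value by at most a constant times `ε`, which is less than `√(D ε)` for small
`ε`.
-/

noncomputable section

/-! ### Probabilistic preliminaries -/

/-- A stochastic matrix has a stationary probability vector: the entrywise absolute value of a left
eigenvector for the eigenvalue `1` is again an eigenvector. -/
theorem exists_stationary_vector {X : Type*} [Fintype X] [Nonempty X] [DecidableEq X]
    (Q : X → X → ℝ) (hQ : ∀ i j, 0 ≤ Q i j) (hQ1 : ∀ i, ∑ j, Q i j = 1) :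
    ∃ x : X → ℝ, (∀ i, 0 ≤ x i) ∧ ∑ i, x i = 1 ∧ ∀ j, ∑ i, x i * Q i j = x j := by
  -- `Q - 1` kills the constant vector, so it also has a left null vector
  have hdet : (Matrix.of Q - 1).det = 0 := by
    rw [← Matrix.exists_mulVec_eq_zero_iff]
    refine ⟨1, one_ne_zero, ?_⟩
    ext i
    rw [Matrix.sub_mulVec, Matrix.one_mulVec]
    simp [Matrix.mulVec, dotProduct, hQ1]
  obtain ⟨v, hv0, hv⟩ := Matrix.exists_vecMul_eq_zero_iff.mpr hdet
  have hv' : ∀ j, ∑ i, v i * Q i j = v j := by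
    intro j
    have := congrFun hv j
    simp only [Matrix.vecMul_sub, Matrix.vecMul_one, Pi.sub_apply, Pi.zero_apply] at this
    simpa [Matrix.vecMul, dotProduct] using sub_eq_zero.mp this
  have hle : ∀ j, |v j| ≤ ∑ i, |v i| * Q i j := by
    intro j
    rw [← hv' j]
    refine (Finset.abs_sum_le_sum_abs _ _).trans (Finset.sum_le_sum fun i _ => ?_)
    rw [abs_mul, abs_of_nonneg (hQ i j)]
  have hsum : ∑ j, |v j| = ∑ j, ∑ i, |v i| * Q i j := by
    rw [Finset.sum_comm]
    simp [← Finset.mul_sum, hQ1]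
  -- the two sides of `hle` have the same sum, so they agree
  have heq := (Finset.sum_eq_sum_iff_of_le (fun j _ => hle j)).mp hsum
  obtain ⟨i₀, hi₀⟩ := Function.ne_iff.mp hv0
  have hpos : 0 < ∑ j, |v j| :=
    Finset.sum_pos' (fun _ _ => abs_nonneg _) ⟨i₀, Finset.mem_univ _, abs_pos.mpr hi₀⟩
  refine ⟨fun i => |v i| / ∑ j, |v j|, fun i => by positivity, ?_, fun j => ?_⟩
  · rw [← Finset.sum_div, div_self hpos.ne']
  · beta_reduce
    rw [heq j (Finset.mem_univ _), Finset.sum_div]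
    exact Finset.sum_congr rfl fun i _ => by ring

/-- A random map on a finite set has a stationary law. -/
theorem exists_stationary_measure {X E : Type*} [Fintype X] [Nonempty X] [MeasurableSpace X]
    [MeasurableSingletonClass X] [MeasurableSpace E] (ν : Measure E) [IsProbabilityMeasure ν]
    (Φ : X → E → X) (hΦ : ∀ x, Measurable (Φ x)) :
    ∃ π : Measure X, IsProbabilityMeasure π ∧ (π.prod ν).map (fun z => Φ z.1 z.2) = π := by
  classical
  have hm : Measurable (fun z : X × E => Φ z.1 z.2) := measurable_from_prod_countable_right hΦ
  obtain ⟨x, hx0, hx1, hx⟩ := exists_stationary_vector (fun i j => ν.real (Φ i ⁻¹' {j}))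
    (fun _ _ => measureReal_nonneg) (fun i => by
      rw [sum_measureReal_preimage_singleton _ fun j _ => hΦ i (measurableSet_singleton j)]
      simp)
  let π : Measure X := ∑ i, ENNReal.ofReal (x i) • Measure.dirac i
  have hπ : ∀ j, π {j} = ENNReal.ofReal (x j) := by
    intro j
    simp only [π, Measure.finsetSum_apply, Measure.smul_apply, Measure.dirac_apply, smul_eq_mul]
    rw [Finset.sum_eq_single j] <;> simp +contextual
  have hprob : IsProbabilityMeasure π := by
    constructor
    simp only [π, Measure.finsetSum_apply, Measure.smul_apply, measure_univ, smul_eq_mul, mul_one]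
    rw [← ENNReal.ofReal_sum_of_nonneg fun i _ => hx0 i, hx1, ENNReal.ofReal_one]
  refine ⟨π, hprob, Measure.ext_of_singleton fun j => ?_⟩
  rw [Measure.map_apply hm (measurableSet_singleton j),
    Measure.prod_apply (hm (measurableSet_singleton j)), lintegral_fintype, hπ, ← hx j,
    ENNReal.ofReal_sum_of_nonneg fun i _ => mul_nonneg (hx0 i) measureReal_nonneg]
  refine Finset.sum_congr rfl fun i _ => ?_
  rw [hπ, ENNReal.ofReal_mul (hx0 i), ofReal_measureReal, mul_comm]
  rfl

theorem abs_sqrt_variance_sub_le {Ω : Type*} [MeasurableSpace Ω] {μ : Measure Ω}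
    [IsProbabilityMeasure μ] {X Y : Ω → ℝ} (hX : MemLp X 2 μ) (hY : MemLp Y 2 μ) {B : ℝ}
    (hB : 0 ≤ B) (hXY : ∀ᵐ ω ∂μ, |X ω - Y ω| ≤ B) :
    |√(variance X μ) - √(variance Y μ)| ≤ B := by
  -- the standard deviation is the norm of the centred variable in `L²`
  have key : ∀ {Z : Ω → ℝ} (hZ : MemLp Z 2 μ), √(variance Z μ) =
      (eLpNorm (fun ω => Z ω - ∫ ω, Z ω ∂μ) 2 μ).toReal := by
    intro Z hZ
    have hc : MemLp (fun ω => Z ω - ∫ ω, Z ω ∂μ) 2 μ := hZ.sub (memLp_const _)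
    rw [variance_eq_integral hZ.aestronglyMeasurable.aemeasurable,
      hc.eLpNorm_eq_integral_rpow_norm (by norm_num) (by norm_num), ENNReal.toReal_ofReal
        (by positivity), Real.sqrt_eq_rpow]
    simp
  have tri : ∀ {Z Z' : Ω → ℝ}, MemLp Z 2 μ → MemLp Z' 2 μ → (∀ᵐ ω ∂μ, |Z ω - Z' ω| ≤ B) →
      √(variance Z μ) ≤ √(variance Z' μ) + B := by
    intro Z Z' hZ hZ' hb
    have hc : MemLp (fun ω => Z' ω - ∫ ω, Z' ω ∂μ) 2 μ := hZ'.sub (memLp_const _)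
    have hd : MemLp (fun ω => Z ω - Z' ω) 2 μ := hZ.sub hZ'
    have hcd : MemLp (fun ω => (Z ω - Z' ω) - ∫ ω, (Z ω - Z' ω) ∂μ) 2 μ := hd.sub (memLp_const _)
    have hsum : (fun ω => Z ω - ∫ ω, Z ω ∂μ) = (fun ω => Z' ω - ∫ ω, Z' ω ∂μ) +
        fun ω => (Z ω - Z' ω) - ∫ ω, (Z ω - Z' ω) ∂μ := by
      ext ω
      simp only [Pi.add_apply]
      rw [integral_sub (hZ.integrable (by norm_num)) (hZ'.integrable (by norm_num))]
      ring
    have hsd : √(variance (fun ω => Z ω - Z' ω) μ) ≤ B := by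
      rw [Real.sqrt_le_left hB]
      refine (variance_le_expectation_sq hd.aestronglyMeasurable).trans ?_
      calc ∫ ω, ((fun ω => Z ω - Z' ω) ^ 2) ω ∂μ ≤ ∫ _, B ^ 2 ∂μ := by
            refine integral_mono_ae hd.integrable_sq (integrable_const _) ?_
            filter_upwards [hb] with ω hω
            exact sq_le_sq' (abs_le.mp hω).1 (abs_le.mp hω).2
        _ = B ^ 2 := by simp
    rw [key hZ, key hZ', hsum]
    rw [key hd] at hsd
    refine (ENNReal.toReal_mono (ENNReal.add_ne_top.mpr ⟨hc.2.ne, hcd.2.ne⟩)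
      (eLpNorm_add_le hc.1 hcd.1 (by norm_num))).trans ?_
    rw [ENNReal.toReal_add hc.2.ne hcd.2.ne]
    linarith
  have h1 := tri hX hY hXY
  have h2 := tri hY hX (by filter_upwards [hXY] with ω hω; rwa [abs_sub_comm])
  rw [abs_le]
  constructor <;> linarith

theorem tendsto_variance_of_ae_bounded {Ω : Type*} [MeasurableSpace Ω] {μ : Measure Ω}
    [IsProbabilityMeasure μ] {X : ℕ → Ω → ℝ} {Y : Ω → ℝ} {B : ℝ}
    (hX : ∀ t, AEStronglyMeasurable (X t) μ) (hB : ∀ t, ∀ᵐ ω ∂μ, |X t ω| ≤ B)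
    (hlim : ∀ᵐ ω ∂μ, Tendsto (fun t => X t ω) atTop (𝓝 (Y ω))) :
    Tendsto (fun t => variance (X t) μ) atTop (𝓝 (variance Y μ)) := by
  have hYm : AEStronglyMeasurable Y μ := aestronglyMeasurable_of_tendsto_ae _ hX hlim
  have hYB : ∀ᵐ ω ∂μ, |Y ω| ≤ B := by
    filter_upwards [hlim, ae_all_iff.mpr hB] with ω h1 h2
    exact le_of_tendsto h1.abs (Eventually.of_forall h2)
  have hX2 : ∀ t, MemLp (X t) 2 μ := fun t => MemLp.of_bound (hX t) B (hB t)
  have hY2 : MemLp Y 2 μ := MemLp.of_bound hYm B hYB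
  simp_rw [variance_eq_sub (hX2 _)]
  rw [variance_eq_sub hY2]
  have hsq : Tendsto (fun t => ∫ ω, X t ω ^ 2 ∂μ) atTop (𝓝 (∫ ω, Y ω ^ 2 ∂μ)) := by
    refine tendsto_integral_of_dominated_convergence (fun _ => B ^ 2) (fun t => (hX t).pow 2)
      (integrable_const _) (fun t => ?_) ?_
    · filter_upwards [hB t] with ω hω
      rw [Real.norm_eq_abs, abs_pow]
      exact pow_le_pow_left₀ (abs_nonneg _) hω 2
    · filter_upwards [hlim] with ω hω using hω.pow 2
  have h1 : Tendsto (fun t => ∫ ω, X t ω ∂μ) atTop (𝓝 (∫ ω, Y ω ∂μ)) :=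
    tendsto_integral_of_dominated_convergence (fun _ => B) hX (integrable_const _) hB hlim
  exact hsq.sub (h1.pow 2)

/-- If `X` is independent of the pair `(Y, Z)` and `Y` of `Z`, then `(X, Y)` is independent
of `Z`. -/
theorem ProbabilityTheory.IndepFun.prodMk_left_of_prodMk_right {Ω α β γ : Type*}
    [MeasurableSpace Ω] [MeasurableSpace α] [MeasurableSpace β] [MeasurableSpace γ]
    {μ : Measure Ω} [IsProbabilityMeasure μ] {X : Ω → α} {Y : Ω → β} {Z : Ω → γ}
    (hX : Measurable X) (hY : Measurable Y) (hZ : Measurable Z)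
    (hXYZ : IndepFun X (fun ω => (Y ω, Z ω)) μ) (hYZ : IndepFun Y Z μ) :
    IndepFun (fun ω => (X ω, Y ω)) Z μ := by
  have hXY : IndepFun X Y μ := hXYZ.comp measurable_id measurable_fst
  have : IsProbabilityMeasure (μ.map X) := Measure.isProbabilityMeasure_map hX.aemeasurable
  have : IsProbabilityMeasure (μ.map Y) := Measure.isProbabilityMeasure_map hY.aemeasurable
  have : IsProbabilityMeasure (μ.map Z) := Measure.isProbabilityMeasure_map hZ.aemeasurable
  rw [indepFun_iff_map_prod_eq_prod_map_map (by fun_prop) (by fun_prop)] at hXYZ hYZ hXY ⊢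
  rw [hXY]
  have e : (fun ω => ((X ω, Y ω), Z ω)) =
      MeasurableEquiv.prodAssoc.symm ∘ fun ω => (X ω, (Y ω, Z ω)) := rfl
  rw [e, ← Measure.map_map (by fun_prop) (by fun_prop), hXYZ, hYZ]
  exact ((MeasurePreserving.symm _ (measurePreserving_prodAssoc _ _ _))).map_eq

namespace CongestionGame

variable (G : CongestionGame)

/-! ### The decision rule of the players -/

theorem isProbabilityMeasure_weightLaw : IsProbabilityMeasure G.weightLaw := G.weight_prob

theorem isProbabilityMeasure_urgencyLaw : IsProbabilityMeasure G.urgencyLaw := G.urgency_prob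

attribute [instance] isProbabilityMeasure_weightLaw isProbabilityMeasure_urgencyLaw

/-- The largest share of resource `0` in the future that a player with level `k` can afford after
choosing `r` now. For `T = 0` the value is irrelevant, since the share then does not matter. -/
def maxShare (p : Fin 2 → ℝ) (k : ℝ) (r : Fin 2) : ℝ :=
  min 1 ((k - p r - G.T * G.Pgo * p 1) / (G.T * G.Pgo * (p 0 - p 1)))

/-- The urgency above which a player with level `k` prefers resource `0` now to a larger share of
resource `0` in the future. It does not depend on the latencies: both sides of the comparison are
proportional to the gap between the two latencies. -/
def threshold (p : Fin 2 → ℝ) (k : ℝ) : ℝ :=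
  G.T * G.Pgo * (∫ v, v ∂G.urgencyLaw) * (G.maxShare p k 1 - G.maxShare p k 0)

/-- The best response of a player with level `k` and urgency `u` when resource `0` is faster; ties
are resolved in favour of resource `0`. -/
def decision (p : Fin 2 → ℝ) (k u : ℝ) : Fin 2 :=
  open Classical in if p 0 ≤ k ∧ G.threshold p k ≤ u then 0 else 1

theorem feasible_maxShare {p : Fin 2 → ℝ} {k : ℝ} {r : Fin 2} (h1 : p 1 ≤ 0) (h01 : p 1 < p 0)
    (hr : p r ≤ k) : G.Feasible p k r (G.maxShare p k r) := by
  have hc : 0 ≤ G.T * G.Pgo := mul_nonneg (Nat.cast_nonneg _) G.Pgo_pos.le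
  have hnum : 0 ≤ k - p r - G.T * G.Pgo * p 1 := by nlinarith
  refine ⟨⟨le_min zero_le_one (div_nonneg hnum (mul_nonneg hc (by linarith))), min_le_left _ _⟩,
    hr, ?_⟩
  rcases hc.eq_or_lt with hc0 | hc0
  · rw [← hc0]
    linarith
  · have hd : 0 < G.T * G.Pgo * (p 0 - p 1) := mul_pos hc0 (by linarith)
    have hy := (le_div_iff₀ hd).mp (min_le_right 1
      ((k - p r - G.T * G.Pgo * p 1) / (G.T * G.Pgo * (p 0 - p 1))))
    change G.maxShare p k r * _ ≤ _ at hy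
    linarith

theorem Feasible.mul_le_maxShare {G : CongestionGame} {p : Fin 2 → ℝ} {k y : ℝ} {r : Fin 2}
    (h01 : p 1 < p 0) (hf : G.Feasible p k r y) :
    G.T * G.Pgo * y ≤ G.T * G.Pgo * G.maxShare p k r := by
  obtain ⟨⟨_, hy⟩, _, hb⟩ := hf
  have hc : 0 ≤ G.T * G.Pgo := mul_nonneg (Nat.cast_nonneg _) G.Pgo_pos.le
  rcases hc.eq_or_lt with hc0 | hc0
  · simp [← hc0]
  · refine mul_le_mul_of_nonneg_left (le_min hy ?_) hc
    rw [le_div_iff₀ (mul_pos hc0 (by linarith))]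
    linarith

theorem mean_urgency_nonneg : 0 ≤ ∫ v, v ∂G.urgencyLaw :=
  integral_nonneg_of_ae G.urgency_nonneg

theorem planCost_maxShare_le {p lat : Fin 2 → ℝ} {k u y : ℝ} {r : Fin 2} (h01 : p 1 < p 0)
    (hlat : lat 0 < lat 1) (hf : G.Feasible p k r y) :
    G.planCost lat u r (G.maxShare p k r) ≤ G.planCost lat u r y := by
  have h := mul_le_mul_of_nonneg_left (hf.mul_le_maxShare h01)
    (mul_nonneg G.mean_urgency_nonneg (sub_nonneg.mpr hlat.le))
  unfold planCost
  linarith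

theorem planCost_maxShare_sub (p lat : Fin 2 → ℝ) (k u : ℝ) :
    G.planCost lat u 1 (G.maxShare p k 1) - G.planCost lat u 0 (G.maxShare p k 0) =
      (lat 1 - lat 0) * (u - G.threshold p k) := by
  unfold planCost threshold
  ring

theorem isBestResponse_iff_eq_decision {p lat : Fin 2 → ℝ} {k u : ℝ} (h1 : p 1 ≤ 0)
    (h01 : p 1 < p 0) (hk : 0 ≤ k) (hlat : lat 0 < lat 1) (hu : u ≠ G.threshold p k)
    (r : Fin 2) : G.IsBestResponse lat p k u r ↔ r = G.decision p k u := by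
  have hcmp := G.planCost_maxShare_sub p lat k u
  have hf1 := G.feasible_maxShare h1 h01 (h1.trans hk)
  by_cases h : p 0 ≤ k ∧ G.threshold p k ≤ u
  · have hf0 := G.feasible_maxShare h1 h01 h.1
    have hlt : 0 < (lat 1 - lat 0) * (u - G.threshold p k) :=
      mul_pos (by linarith) (sub_pos.mpr (lt_of_le_of_ne h.2 hu.symm))
    have hd : G.decision p k u = 0 := if_pos h
    rw [hd]
    constructor
    · rintro ⟨y, hy, hmin⟩
      by_contra hr
      obtain rfl : r = 1 := by omega
      linarith [hmin 0 _ hf0, G.planCost_maxShare_le (u := u) h01 hlat hy]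
    · rintro rfl
      refine ⟨_, hf0, fun r' y' hf' => ?_⟩
      have := G.planCost_maxShare_le (u := u) h01 hlat hf'
      obtain rfl | rfl : r' = 0 ∨ r' = 1 := by omega
      · exact this
      · linarith
  · have hd : G.decision p k u = 1 := if_neg h
    rw [hd]
    have hlt : p 0 ≤ k → (lat 1 - lat 0) * (u - G.threshold p k) < 0 := fun hp =>
      mul_neg_of_pos_of_neg (by linarith) (by
        have : ¬ G.threshold p k ≤ u := fun h' => h ⟨hp, h'⟩
        linarith)
    constructor
    · rintro ⟨y, hy, hmin⟩
      by_contra hr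
      obtain rfl : r = 0 := by omega
      linarith [hlt hy.2.1, hmin 1 _ hf1, G.planCost_maxShare_le (u := u) h01 hlat hy]
    · rintro rfl
      refine ⟨_, hf1, fun r' y' hf' => ?_⟩
      have := G.planCost_maxShare_le (u := u) h01 hlat hf'
      obtain rfl | rfl : r' = 0 ∨ r' = 1 := by omega
      · linarith [hlt hf'.2.1]
      · exact this

theorem measurable_maxShare (r : Fin 2) :
    Measurable fun z : (Fin 2 → ℝ) × ℝ => G.maxShare z.1 z.2 r := by
  unfold maxShare
  fun_prop

theorem measurable_threshold : Measurable fun z : (Fin 2 → ℝ) × ℝ => G.threshold z.1 z.2 := by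
  have := G.measurable_maxShare
  unfold threshold
  fun_prop

theorem measurable_decision :
    Measurable fun z : (Fin 2 → ℝ) × ℝ × ℝ => G.decision z.1 z.2.1 z.2.2 := by
  have h := G.measurable_threshold
  unfold decision
  refine Measurable.ite (MeasurableSet.inter ?_ ?_) measurable_const measurable_const
  · exact measurableSet_le (by fun_prop : Measurable fun z : (Fin 2 → ℝ) × ℝ × ℝ => z.1 0)
      (by fun_prop)
  · exact measurableSet_le (h.comp (by fun_prop : Measurable fun z : (Fin 2 → ℝ) × ℝ × ℝ =>
      (z.1, z.2.1))) (by fun_prop)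

/-! ### Stationary currency levels for a fixed price vector -/

/-- The law of whether a player participates at a given time. -/
def participationLaw : Measure Bool :=
  ENNReal.ofReal G.Pgo • Measure.dirac true + ENNReal.ofReal (1 - G.Pgo) • Measure.dirac false

/-- The joint law of participation and urgency of a player at a given time. -/
def noise : Measure (Bool × ℝ) := G.participationLaw.prod G.urgencyLaw

theorem isProbabilityMeasure_participationLaw : IsProbabilityMeasure G.participationLaw := by
  constructor
  simp only [participationLaw, Measure.add_apply, Measure.smul_apply, measure_univ, smul_eq_mul,
    mul_one]
  rw [← ENNReal.ofReal_add G.Pgo_pos.le (by linarith [G.Pgo_le_one])]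
  simp

attribute [instance] isProbabilityMeasure_participationLaw

theorem isProbabilityMeasure_noise : IsProbabilityMeasure G.noise := by
  unfold noise
  infer_instance

attribute [instance] isProbabilityMeasure_noise

theorem noise_real_participate : G.noise.real {e | e.1 = true} = G.Pgo := by
  have : {e : Bool × ℝ | e.1 = true} = {true} ×ˢ Set.univ := by ext; simp
  rw [this, Measure.real, noise, Measure.prod_prod]
  simp [participationLaw, G.Pgo_pos.le]

theorem ae_noise_of_ae_urgencyLaw {s : Set ℝ} (h : ∀ᵐ u ∂G.urgencyLaw, u ∈ s) :
    ∀ᵐ e ∂G.noise, e.2 ∈ s :=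
  Measure.quasiMeasurePreserving_snd.ae h

/-- The level of a player after one time step, given participation and urgency `e`. -/
def nextLevel (p : Fin 2 → ℝ) (k : ℝ) (e : Bool × ℝ) : ℝ :=
  if e.1 = true then k - p (G.decision p k e.2) else k

theorem measurable_nextLevel :
    Measurable fun z : (Fin 2 → ℝ) × ℝ × (Bool × ℝ) => G.nextLevel z.1 z.2.1 z.2.2 := by
  have hd : Measurable fun z : (Fin 2 → ℝ) × ℝ × (Bool × ℝ) => G.decision z.1 z.2.1 z.2.2.2 :=
    G.measurable_decision.comp (by fun_prop : Measurable
      fun z : (Fin 2 → ℝ) × ℝ × (Bool × ℝ) => (z.1, z.2.1, z.2.2.2))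
  have hp : Measurable fun z : ((Fin 2 → ℝ) × Fin 2) => z.1 z.2 :=
    measurable_from_prod_countable_left fun r => measurable_pi_apply r
  unfold nextLevel
  refine Measurable.ite ?_ ?_ (by fun_prop)
  · exact (by fun_prop : Measurable fun z : (Fin 2 → ℝ) × ℝ × (Bool × ℝ) => z.2.2.1)
      (measurableSet_singleton true)
  · exact (by fun_prop : Measurable fun z : (Fin 2 → ℝ) × ℝ × (Bool × ℝ) => z.2.1).sub
      (hp.comp (measurable_fst.prodMk hd))

theorem price_decision_le {p : Fin 2 → ℝ} {k : ℝ} (u : ℝ) (h1 : p 1 ≤ 0) (hk : 0 ≤ k) :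
    p (G.decision p k u) ≤ k := by
  unfold decision
  split_ifs with h
  · exact h.1
  · exact h1.trans hk

/-- A player rich enough to choose resource `0` throughout the planning horizon does so. -/
theorem decision_eq_zero_of_le {p : Fin 2 → ℝ} {k u : ℝ} (h0 : 0 ≤ p 0) (h1 : p 1 ≤ 0)
    (hk : p 0 * (1 + G.T) ≤ k) (hu : 0 ≤ u) : G.decision p k u = 0 := by
  have hT : (0 : ℝ) ≤ G.T := Nat.cast_nonneg _
  have hc : 0 ≤ G.T * G.Pgo := mul_nonneg hT G.Pgo_pos.le
  have hcT : G.T * G.Pgo ≤ G.T := mul_le_of_le_one_right hT G.Pgo_le_one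
  have hp0 : p 0 * (G.T * G.Pgo) ≤ p 0 * G.T := mul_le_mul_of_nonneg_left hcT h0
  have hthr : G.threshold p k = 0 := by
    rcases (mul_nonneg hc (by linarith : 0 ≤ p 0 - p 1)).eq_or_lt with hd | hd
    · simp [threshold, maxShare, ← hd]
    · have hone : ∀ r, p r ≤ p 0 → G.maxShare p k r = 1 := fun r hr =>
        min_eq_left ((one_le_div hd).mpr (by nlinarith))
      simp [threshold, hone 0 le_rfl, hone 1 (by linarith)]
  refine if_pos ⟨?_, hthr.trans_le hu⟩
  nlinarith [mul_nonneg h0 hT]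

/-- Prices on a lattice keep the levels on a finite set, and hence admit a bounded stationary
law. -/
theorem exists_stationary_level {p : Fin 2 → ℝ} {s : ℝ} (hs : 0 < s) {a b : ℕ}
    (h0 : p 0 = s * a) (h1 : p 1 = -(s * b)) :
    ∃ π : Measure ℝ, IsProbabilityMeasure π ∧ (∃ B, ∀ᵐ k ∂π, k ∈ Set.Icc 0 B) ∧
      (π.prod G.noise).map (fun z => G.nextLevel p z.1 z.2) = π := by
  have hp0 : 0 ≤ p 0 := by rw [h0]; positivity
  have hp1 : p 1 ≤ 0 := by rw [h1]; simp only [neg_nonpos]; positivity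
  let M := a * (1 + G.T) + b
  let Φ : Fin (M + 1) → Bool × ℝ → Fin (M + 1) := fun i e =>
    if e.1 = true then
      if G.decision p (s * (i : ℕ)) e.2 = 0 then ⟨i - a, by omega⟩
      else ⟨min (i + b) M, by omega⟩
    else i
  have hdec : ∀ k : ℝ, Measurable fun e : Bool × ℝ => G.decision p k e.2 := fun k =>
    G.measurable_decision.comp (by fun_prop : Measurable fun e : Bool × ℝ => (p, k, e.2))
  have hΦ : ∀ i, Measurable (Φ i) := fun i => by
    refine Measurable.ite (measurable_fst (measurableSet_singleton true)) ?_ measurable_const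
    exact Measurable.ite (hdec _ (measurableSet_singleton 0)) measurable_const measurable_const
  obtain ⟨π, hπ, hstat⟩ := exists_stationary_measure G.noise Φ hΦ
  let g : Fin (M + 1) → ℝ := fun i => s * (i : ℕ)
  have hg : Measurable g := measurable_of_countable g
  -- on the lattice, and for nonnegative urgencies, the finite chain is the chain of the levels
  have hstep : ∀ i, ∀ e : Bool × ℝ, 0 ≤ e.2 → G.nextLevel p (g i) e = g (Φ i e) := by
    intro i e he
    by_cases hP : e.1 = true
    · by_cases hD : G.decision p (g i) e.2 = 0
      · have hle := G.price_decision_le e.2 hp1 (by positivity : 0 ≤ g i)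
        rw [hD, h0] at hle
        have hai : a ≤ (i : ℕ) := by exact_mod_cast le_of_mul_le_mul_left hle hs
        simp only [nextLevel, Φ, hP, if_true, hD, g, h0]
        rw [Nat.cast_sub hai]
        ring
      · have hlt : (i : ℕ) < a * (1 + G.T) := by
          by_contra! hge
          refine hD (G.decision_eq_zero_of_le hp0 hp1 ?_ he)
          rw [h0, mul_assoc]
          exact mul_le_mul_of_nonneg_left (by exact_mod_cast hge) hs.le
        have hmin : min ((i : ℕ) + b) M = i + b := min_eq_left (by omega)
        have hD1 : G.decision p (g i) e.2 = 1 := by omega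
        simp only [nextLevel, Φ, hP, if_true, hD1, g, h1, hmin]
        push_cast
        ring
    · simp [nextLevel, Φ, hP]
  have hnext : Measurable fun z : ℝ × (Bool × ℝ) => G.nextLevel p z.1 z.2 :=
    G.measurable_nextLevel.comp (by fun_prop : Measurable fun z : ℝ × (Bool × ℝ) =>
      (p, z.1, z.2))
  refine ⟨π.map g, Measure.isProbabilityMeasure_map hg.aemeasurable, ⟨s * M, ?_⟩, ?_⟩
  · refine (ae_map_iff hg.aemeasurable measurableSet_Icc).mpr ?_
    refine Eventually.of_forall fun i => ⟨by positivity, ?_⟩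
    exact mul_le_mul_of_nonneg_left (by exact_mod_cast Nat.lt_succ_iff.mp i.2) hs.le
  · have hprod : (π.map g).prod G.noise = (π.prod G.noise).map (Prod.map g id) := by
      rw [← Measure.map_prod_map _ _ hg measurable_id, Measure.map_id]
    have hae : (fun z : Fin (M + 1) × (Bool × ℝ) => G.nextLevel p (g z.1) z.2) =ᵐ[π.prod G.noise]
        g ∘ fun z => Φ z.1 z.2 := by
      have := Measure.quasiMeasurePreserving_snd (μ := π) (ν := G.noise) |>.ae
        (G.ae_noise_of_ae_urgencyLaw (s := Set.Ici 0) G.urgency_nonneg)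
      filter_upwards [this] with z hz using hstep z.1 z.2 hz
    rw [hprod, Measure.map_map hnext (hg.prodMap measurable_id)]
    change (π.prod G.noise).map
      (fun z : Fin (M + 1) × (Bool × ℝ) => G.nextLevel p (g z.1) z.2) = _
    rw [Measure.map_congr hae, ← Measure.map_map hg (measurable_from_prod_countable_right hΦ),
      hstat]

/-- The event that a player participates and chooses resource `0`, in terms of level and noise. -/
def choosesFirst (p : Fin 2 → ℝ) : Set (ℝ × (Bool × ℝ)) :=
  {z | z.2.1 = true ∧ G.decision p z.1 z.2.2 = 0}

theorem measurableSet_choosesFirst (p : Fin 2 → ℝ) : MeasurableSet (G.choosesFirst p) := by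
  refine MeasurableSet.inter ?_ ?_
  · exact (by fun_prop : Measurable fun z : ℝ × (Bool × ℝ) => z.2.1) (measurableSet_singleton true)
  · exact G.measurable_decision.comp (by fun_prop : Measurable fun z : ℝ × (Bool × ℝ) =>
      (p, z.1, z.2.2)) (measurableSet_singleton 0)

/-- In a stationary state the expected payment vanishes, which determines the rate at which
resource `0` is chosen. -/
theorem stationary_rate {p : Fin 2 → ℝ} {π : Measure ℝ} [IsProbabilityMeasure π] {B : ℝ}
    (hB : ∀ᵐ k ∂π, k ∈ Set.Icc 0 B)
    (hstat : (π.prod G.noise).map (fun z => G.nextLevel p z.1 z.2) = π) :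
    (π.prod G.noise).real (G.choosesFirst p) * (p 0 - p 1) = -p 1 * G.Pgo := by
  have hnext : Measurable fun z : ℝ × (Bool × ℝ) => G.nextLevel p z.1 z.2 :=
    G.measurable_nextLevel.comp (by fun_prop : Measurable fun z : ℝ × (Bool × ℝ) =>
      (p, z.1, z.2))
  have hint : Integrable (fun k : ℝ => k) π := by
    refine Integrable.of_bound measurable_id.aestronglyMeasurable B ?_
    filter_upwards [hB] with k hk
    rw [Real.norm_eq_abs, abs_of_nonneg hk.1]
    exact hk.2
  have hint1 : Integrable (fun z : ℝ × (Bool × ℝ) => z.1) (π.prod G.noise) := hint.comp_fst _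
  let go : Set (ℝ × (Bool × ℝ)) := {z | z.2.1 = true}
  have hgo : MeasurableSet go :=
    (by fun_prop : Measurable fun z : ℝ × (Bool × ℝ) => z.2.1) (measurableSet_singleton true)
  have hgoP : (π.prod G.noise).real go = G.Pgo := by
    have : go = Set.univ ×ˢ {e | e.1 = true} := by ext; simp [go]
    rw [this, measureReal_prod_prod, G.noise_real_participate]
    simp
  have hform : ∀ z : ℝ × (Bool × ℝ), G.nextLevel p z.1 z.2 = z.1 - (go.indicator (fun _ => p 1) z +
      (G.choosesFirst p).indicator (fun _ => p 0 - p 1) z) := by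
    intro z
    by_cases hP : z.2.1 = true
    · by_cases hD : G.decision p z.1 z.2.2 = 0
      · simp [nextLevel, go, choosesFirst, Set.indicator, hP, hD]
      · have hD1 : G.decision p z.1 z.2.2 = 1 := by omega
        simp [nextLevel, go, choosesFirst, Set.indicator, hP, hD1]
    · simp [nextLevel, go, choosesFirst, Set.indicator, hP]
  have hmean : ∫ k, k ∂π = ∫ z, G.nextLevel p z.1 z.2 ∂(π.prod G.noise) := by
    conv_lhs => rw [← hstat]
    exact integral_map hnext.aemeasurable measurable_id.aestronglyMeasurable
  have hfst : ∫ z, z.1 ∂(π.prod G.noise) = ∫ k, k ∂π := by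
    have := integral_fun_fst (μ := π) (ν := G.noise) (fun k : ℝ => k)
    simpa using this
  have hi1 : Integrable (go.indicator fun _ => p 1) (π.prod G.noise) :=
    (integrable_const _).indicator hgo
  have hi2 : Integrable ((G.choosesFirst p).indicator fun _ => p 0 - p 1) (π.prod G.noise) :=
    (integrable_const _).indicator (G.measurableSet_choosesFirst p)
  simp_rw [hform] at hmean
  rw [integral_sub (g := fun z => _ + _) hint1 (hi1.add hi2), integral_add hi1 hi2, hfst,
    integral_indicator_const _ hgo, integral_indicator_const _ (G.measurableSet_choosesFirst p), hgoP] at hmean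
  simp only [smul_eq_mul] at hmean
  linarith

end CongestionGame

namespace CongestionGame

variable (G : CongestionGame)

/-! ### The system optimum and the design equation -/

theorem cost_eq (w : Fin 2 → ℝ) : G.cost w = w 0 * G.l 0 (w 0) + w 1 * G.l 1 (w 1) := by
  simp [cost, Fin.sum_univ_two]

variable {G} {wstar : Fin 2 → ℝ} {LC θ δ : ℝ}

theorem IsOptimum.add_eq (hopt : G.IsOptimum wstar) : wstar 0 + wstar 1 = G.Pgo := by
  simpa [Fin.sum_univ_two] using hopt.1.2

theorem IsOptimum.mem_Icc (hopt : G.IsOptimum wstar) (r : Fin 2) :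
    wstar r ∈ Set.Icc 0 G.Pgo := by
  have h0 := hopt.1.1 0
  have h1 := hopt.1.1 1
  have := hopt.add_eq
  obtain rfl | rfl : r = 0 ∨ r = 1 := by omega
  · exact ⟨h0, by linarith⟩
  · exact ⟨h1, by linarith⟩

/-- If resource `0` is strictly faster at the optimum, then it is used at the optimum: otherwise
moving a few players to it would lower the societal cost. -/
theorem IsOptimum.first_pos (hopt : G.IsOptimum wstar)
    (hlat : G.l 0 (wstar 0) < G.l 1 (wstar 1)) : 0 < wstar 0 := by
  by_contra hneg
  have h0 : wstar 0 = 0 := le_antisymm (not_lt.mp hneg) (hopt.1.1 0)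
  have h1 : wstar 1 = G.Pgo := by linarith [hopt.add_eq]
  rw [h0, h1] at hlat
  have hev : ∀ᶠ x in 𝓝[>] (0 : ℝ), G.l 0 x < G.l 1 G.Pgo := by
    rw [← nhdsWithin_Ioo_eq_nhdsGT G.Pgo_pos]
    exact ((G.l_continuous 0 0 ⟨le_rfl, G.Pgo_pos.le⟩).mono Set.Ioo_subset_Icc_self).eventually
      (Iio_mem_nhds hlat)
  obtain ⟨x, hx, hx0, hxP⟩ := (hev.and (Ioo_mem_nhdsGT G.Pgo_pos)).exists
  have hmin : G.cost wstar ≤ G.cost ![x, G.Pgo - x] := hopt.2 (by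
    refine ⟨fun r => ?_, by simp⟩
    fin_cases r
    · exact hx0.le
    · exact sub_nonneg.mpr hxP.le)
  have hmono : G.l 1 (G.Pgo - x) ≤ G.l 1 G.Pgo :=
    G.l_monotone 1 ⟨by linarith, by linarith⟩ ⟨G.Pgo_pos.le, le_rfl⟩ (by linarith)
  rw [G.cost_eq, G.cost_eq, h0, h1] at hmin
  simp only [Matrix.cons_val_zero, Matrix.cons_val_one] at hmin
  nlinarith [mul_le_mul_of_nonneg_left hmono (by linarith : 0 ≤ G.Pgo - x),
    mul_lt_mul_of_pos_left hx hx0]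

theorem mul_latency_mono (r : Fin 2) {x y : ℝ} (hx : 0 ≤ x) (hxy : x ≤ y) (hy : y ≤ G.Pgo) :
    x * G.l r x ≤ y * G.l r y :=
  mul_le_mul hxy (G.l_monotone r ⟨hx, hxy.trans hy⟩ ⟨hx.trans hxy, hy⟩ hxy)
    (G.l_nonneg r x ⟨hx, hxy.trans hy⟩) (hx.trans hxy)

theorem CostLipschitz.abs_mul_latency_sub_le (hC : G.CostLipschitz LC) (r : Fin 2) {x y : ℝ}
    (hx : x ∈ Set.Icc 0 G.Pgo) (hy : y ∈ Set.Icc 0 G.Pgo) :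
    |x * G.l r x - y * G.l r y| ≤ LC * |x - y| := by
  have h0 : (0 : ℝ) ∈ Set.Icc 0 G.Pgo := ⟨le_rfl, G.Pgo_pos.le⟩
  obtain rfl | rfl : r = 0 ∨ r = 1 := by omega
  · have := hC ![x, 0] ![y, 0] (fun r => by fin_cases r <;> assumption)
      (fun r => by fin_cases r <;> assumption)
    simpa [G.cost_eq, Fin.sum_univ_two] using this
  · have := hC ![0, x] ![0, y] (fun r => by fin_cases r <;> assumption)
      (fun r => by fin_cases r <;> assumption)
    simpa [G.cost_eq, Fin.sum_univ_two] using this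

/-- When weight moves from one resource to the other, the cost of only one of the two resources
increases, so that the displacement counts once and not twice. -/
theorem CostLipschitz.cost_le (hC : G.CostLipschitz LC)
    {w w' : Fin 2 → ℝ} (hw : w ∈ G.aggregates) (hw' : w' ∈ G.aggregates) :
    G.cost w' ≤ G.cost w + LC * |w' 0 - w 0| := by
  have hs : w 0 + w 1 = G.Pgo := by simpa [Fin.sum_univ_two] using hw.2
  have hs' : w' 0 + w' 1 = G.Pgo := by simpa [Fin.sum_univ_two] using hw'.2
  have h0 := hw.1 0
  have h1 := hw.1 1
  have h0' := hw'.1 0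
  have h1' := hw'.1 1
  rw [G.cost_eq, G.cost_eq]
  rcases le_total (w 0) (w' 0) with h | h
  · have ha := hC.abs_mul_latency_sub_le 0 (x := w' 0) (y := w 0) ⟨h0', by linarith⟩
      ⟨h0, by linarith⟩
    have hb := mul_latency_mono (G := G) 1 h1' (by linarith : w' 1 ≤ w 1) (by linarith)
    linarith [(abs_le.mp ha).2]
  · have ha := hC.abs_mul_latency_sub_le 1 (x := w' 1) (y := w 1) ⟨h1', by linarith⟩
      ⟨h1, by linarith⟩
    have hb := mul_latency_mono (G := G) 0 h0' h (by linarith)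
    have : |w' 1 - w 1| = |w' 0 - w 0| := by
      rw [abs_sub_comm, show w 1 - w' 1 = w' 0 - w 0 by linarith]
    rw [this] at ha
    linarith [(abs_le.mp ha).2]

theorem CostLipschitz.abs_latency_sub_le (hC : G.CostLipschitz LC) (r : Fin 2)
    {x y : ℝ} (hx : x ∈ Set.Icc 0 G.Pgo) (hy : y ∈ Set.Icc 0 G.Pgo) (hy0 : 0 < y) :
    |G.l r x - G.l r y| ≤ (LC + G.l r G.Pgo) / y * |x - y| := by
  have h := hC.abs_mul_latency_sub_le r hx hy
  have hmax : G.l r x ≤ G.l r G.Pgo := G.l_monotone r hx ⟨G.Pgo_pos.le, le_rfl⟩ hx.2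
  have hx0 := G.l_nonneg r x hx
  rw [div_mul_eq_mul_div, le_div_iff₀ hy0]
  calc |G.l r x - G.l r y| * y = |(x * G.l r x - y * G.l r y) - (x - y) * G.l r x| := by
        rw [← abs_of_pos hy0, ← abs_mul, abs_of_pos hy0]
        congr 1
        ring
    _ ≤ LC * |x - y| + |x - y| * G.l r G.Pgo := by
        refine (abs_sub _ _).trans (add_le_add h ?_)
        rw [abs_mul, abs_of_nonneg hx0]
        exact mul_le_mul_of_nonneg_left hmax (abs_nonneg _)
    _ = (LC + G.l r G.Pgo) * |x - y| := by ring

theorem integrable_weight : Integrable (fun w : ℝ => w) G.weightLaw := by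
  refine Integrable.of_bound measurable_id.aestronglyMeasurable G.wmax ?_
  filter_upwards [G.weight_mem] with w hw
  rw [Real.norm_eq_abs, abs_of_nonneg (G.wmin_pos.le.trans hw.1)]
  exact hw.2

theorem ae_weight_pos : ∀ᵐ w ∂G.weightLaw, 0 < w := by
  filter_upwards [G.weight_mem] with w hw using G.wmin_pos.trans_le hw.1

theorem mean_weight_pos : 0 < ∫ w, w ∂G.weightLaw := by
  refine G.wmin_pos.trans_le ?_
  calc G.wmin = ∫ _, G.wmin ∂G.weightLaw := by simp
    _ ≤ _ := integral_mono_ae (integrable_const _) integrable_weight (by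
      filter_upwards [G.weight_mem] with w hw using hw.1)

theorem n₁_mem_Icc (w : ℝ) : G.n₁ wstar θ w ∈ Set.Icc 0 G.Pgo :=
  ⟨le_max_left _ _, max_le G.Pgo_pos.le (min_le_left _ _)⟩

theorem measurable_n₁ : Measurable (G.n₁ wstar θ) := by
  unfold n₁
  fun_prop

theorem integrable_mul_weight {f : ℝ → ℝ} (hf : AEStronglyMeasurable f G.weightLaw) {B : ℝ}
    (hB : ∀ᵐ w ∂G.weightLaw, |f w| ≤ B) : Integrable (fun w => f w * w) G.weightLaw :=
  integrable_weight.bdd_mul hf hB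

theorem integrable_n₁_mul : Integrable (fun w => G.n₁ wstar θ w * w) G.weightLaw :=
  integrable_mul_weight measurable_n₁.aestronglyMeasurable (B := G.Pgo)
    (Eventually.of_forall fun w => by
      rw [abs_of_nonneg (n₁_mem_Icc w).1]
      exact (n₁_mem_Icc w).2)

/-- If the optimum leaves resource `1` empty, then so does the design. -/
theorem IsDesignSolution.ae_n₁_eq (hθ : G.IsDesignSolution wstar θ) (h : wstar 0 = G.Pgo) :
    ∀ᵐ w ∂G.weightLaw, G.n₁ wstar θ w = G.Pgo := by
  have hint : Integrable (fun w => G.Pgo * w - G.n₁ wstar θ w * w) G.weightLaw :=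
    (integrable_weight.const_mul _).sub integrable_n₁_mul
  have hzero : ∫ w, (G.Pgo * w - G.n₁ wstar θ w * w) ∂G.weightLaw = 0 := by
    rw [integral_sub (integrable_weight.const_mul _) integrable_n₁_mul, ← hθ.2,
      integral_const_mul, h, sub_self]
  rw [integral_eq_zero_iff_of_nonneg_ae _ hint] at hzero
  · filter_upwards [hzero, ae_weight_pos] with w hw hpos
    have : (G.Pgo - G.n₁ wstar θ w) * w = 0 := by simpa [sub_mul] using hw
    rcases mul_eq_zero.mp this with h' | h'
    · linarith
    · exact absurd h' hpos.ne'
  · filter_upwards [ae_weight_pos] with w hpos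
    rw [Pi.zero_apply, ← sub_mul]
    exact mul_nonneg (sub_nonneg.mpr (n₁_mem_Icc w).2) hpos.le

/-! ### The prices -/

/-- The values of `rat δ q` as rational numbers. It vanishes outside the positive reals. -/
def ratValue (δ : ℝ) (q : ℕ → ℚ) (x : ℝ) : ℚ :=
  open Classical in if x ≤ 0 then 0 else q (⌈x / δ⌉₊ - 1)

theorem mem_Ioc_step_iff (hδ : 0 < δ) {x : ℝ} (hx : 0 < x) (j : ℕ) :
    x ∈ Set.Ioc (j * δ) ((j + 1) * δ) ↔ j = ⌈x / δ⌉₊ - 1 := by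
  have hpos : 0 < ⌈x / δ⌉₊ := Nat.ceil_pos.mpr (div_pos hx hδ)
  rw [Set.mem_Ioc, ← lt_div_iff₀ hδ, ← div_le_iff₀ hδ, ← Nat.lt_ceil,
    show (j : ℝ) + 1 = ((j + 1 : ℕ) : ℝ) by push_cast; rfl, ← Nat.ceil_le]
  omega

theorem rat_eq_ratValue (hδ : 0 < δ) (q : ℕ → ℚ) (x : ℝ) : rat δ q x = ratValue δ q x := by
  unfold rat ratValue
  split_ifs with hx
  · rw [Rat.cast_zero]
    refine (tsum_congr fun j => Set.indicator_of_notMem (fun h => ?_) _).trans tsum_zero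
    have : 0 ≤ j * δ := by positivity
    linarith [h.1]
  · rw [tsum_eq_single (⌈x / δ⌉₊ - 1)]
    · exact Set.indicator_of_mem ((mem_Ioc_step_iff hδ (not_le.mp hx) _).mpr rfl) _
    · intro j hj
      exact Set.indicator_of_notMem
        (fun h => hj ((mem_Ioc_step_iff hδ (not_le.mp hx) _).mp h)) _

theorem IsRatSeq.ratValue_nonneg {q : ℕ → ℚ} (hq : IsRatSeq δ q) (x : ℝ) :
    0 ≤ ratValue δ q x := by
  unfold ratValue
  split_ifs
  · exact le_rfl
  · exact (hq _).1.le

theorem IsRatSeq.ratValue_pos {q : ℕ → ℚ} (hq : IsRatSeq δ q) {x : ℝ} (hx : 0 < x) :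
    0 < ratValue δ q x := by
  rw [ratValue, if_neg (not_le.mpr hx)]
  exact (hq _).1

theorem ratValue_zero (δ : ℝ) (q : ℕ → ℚ) : ratValue δ q 0 = 0 := if_pos le_rfl

theorem IsRatSeq.abs_ratValue_sub_le {q : ℕ → ℚ} (hδ : 0 < δ) (hq : IsRatSeq δ q) {x : ℝ}
    (hx : 0 ≤ x) : |(ratValue δ q x : ℝ) - x| ≤ δ := by
  rcases hx.eq_or_lt with rfl | hx
  · simp [ratValue_zero, hδ.le]
  · rw [ratValue, if_neg (not_le.mpr hx)]
    exact ((hq _).2 x ((mem_Ioc_step_iff hδ hx _).mpr rfl)).le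

theorem measurable_ratValue (δ : ℝ) (q : ℕ → ℚ) : Measurable (ratValue δ q) := by
  unfold ratValue
  refine Measurable.ite measurableSet_Iic measurable_const ?_
  exact (measurable_of_countable fun n : ℕ => q (n - 1)).comp
    (Nat.measurable_ceil.comp (measurable_id.div_const δ))

variable (G) in
/-- The data of a weight on which its prices depend: the case in the definition of the prices and
the rational approximation used there. There are only countably many values. -/
def priceIndex (wstar : Fin 2 → ℝ) (θ δ : ℝ) (q : ℕ → ℚ) (w : ℝ) : Bool × ℚ :=
  open Classical in
  if wstar 0 ≤ G.n₁ wstar θ w then (true, ratValue δ q (G.n₂ wstar θ w / G.n₁ wstar θ w))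
  else (false, ratValue δ q (G.n₁ wstar θ w / G.n₂ wstar θ w))

/-- The price vector belonging to an index; `c` is the price of resource `0` in the second case. -/
def pricesOfIndex (S c : ℝ) (i : Bool × ℚ) : Fin 2 → ℝ :=
  if i.1 = true then ![S * i.2, -S] else ![c, -(c * i.2)]

theorem pricesOfIndex_true_zero (S c : ℝ) (x : ℚ) : pricesOfIndex S c (true, x) 0 = S * x := rfl

theorem pricesOfIndex_true_one (S c : ℝ) (x : ℚ) : pricesOfIndex S c (true, x) 1 = -S := rfl

theorem pricesOfIndex_false_zero (S c : ℝ) (x : ℚ) : pricesOfIndex S c (false, x) 0 = c := rfl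

theorem pricesOfIndex_false_one (S c : ℝ) (x : ℚ) :
    pricesOfIndex S c (false, x) 1 = -(c * x) := rfl

theorem prices_eq_pricesOfIndex (hδ : 0 < δ) (S : ℝ) (q : ℕ → ℚ) (w : ℝ) :
    G.prices wstar θ δ S q w =
      pricesOfIndex S (S * ratValue δ q (wstar 1 / wstar 0)) (G.priceIndex wstar θ δ q w) := by
  unfold prices priceIndex pricesOfIndex
  split_ifs <;> simp_all [rat_eq_ratValue hδ]

theorem measurable_priceIndex (q : ℕ → ℚ) : Measurable (G.priceIndex wstar θ δ q) := by
  have h1 : Measurable (G.n₁ wstar θ) := measurable_n₁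
  have h2 : Measurable (G.n₂ wstar θ) := measurable_const.sub h1
  unfold priceIndex
  refine Measurable.ite (measurableSet_le measurable_const h1) ?_ ?_
  · exact measurable_const.prodMk ((measurable_ratValue δ q).comp (h2.div h1))
  · exact measurable_const.prodMk ((measurable_ratValue δ q).comp (h1.div h2))

theorem measurable_prices (hδ : 0 < δ) (S : ℝ) (q : ℕ → ℚ) :
    Measurable (G.prices wstar θ δ S q) := by
  rw [funext (prices_eq_pricesOfIndex hδ S q)]
  exact (measurable_of_countable (pricesOfIndex S _)).comp (measurable_priceIndex q)

/-- The prices of each index lie on a lattice, because the approximations are rational. -/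
theorem exists_lattice_pricesOfIndex {S c : ℝ} (hS : 0 < S) (hc : 0 ≤ c) {i : Bool × ℚ}
    (hi : 0 ≤ i.2) : ∃ s : ℝ, 0 < s ∧ ∃ a b : ℕ,
      pricesOfIndex S c i 0 = s * a ∧ pricesOfIndex S c i 1 = -(s * b) := by
  obtain ⟨t, x⟩ := i
  have hd : (0 : ℝ) < x.den := by exact_mod_cast x.den_pos
  have hx : (x : ℝ) = x.num.toNat / x.den := by
    have hn : ((x.num.toNat : ℤ) : ℝ) = (x.num : ℝ) := by
      rw [Int.toNat_of_nonneg (Rat.num_nonneg.mpr hi)]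
    rw [Rat.cast_def, ← hn, Int.cast_natCast]
  cases t
  · rcases hc.eq_or_lt with rfl | hc
    · exact ⟨1, one_pos, 0, 0, by simp [pricesOfIndex]⟩
    · refine ⟨c / x.den, by positivity, x.den, x.num.toNat, ?_, ?_⟩
      · rw [pricesOfIndex_false_zero]
        field_simp
      · rw [pricesOfIndex_false_one, hx]
        field_simp
  · refine ⟨S / x.den, by positivity, x.num.toNat, x.den, ?_, ?_⟩
    · rw [pricesOfIndex_true_zero, hx]
      field_simp
    · rw [pricesOfIndex_true_one]
      field_simp

variable (G) in
/-- The conditional law `κ w` of the level of a player with weight `w` is stationary under the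
prices `p w`, and the levels are bounded by `B w`. -/
structure IsStationaryKernel (p : ℝ → Fin 2 → ℝ) (κ : Kernel ℝ ℝ) (B : ℝ → ℝ) : Prop where
  measurable_prices : Measurable p
  measurable_bound : Measurable B
  markov : IsMarkovKernel κ
  bounded : ∀ w, ∀ᵐ k ∂(κ w), k ∈ Set.Icc 0 (B w)
  stationary : ∀ w, ((κ w).prod G.noise).map (fun z => G.nextLevel (p w) z.1 z.2) = κ w

theorem exists_isStationaryKernel (hδ : 0 < δ) {S : ℝ} (hS : 0 < S) {q : ℕ → ℚ}
    (hq : IsRatSeq δ q) :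
    ∃ κ B, G.IsStationaryKernel (G.prices wstar θ δ S q) κ B := by
  have hc : 0 ≤ S * (ratValue δ q (wstar 1 / wstar 0) : ℝ) :=
    mul_nonneg hS.le (by exact_mod_cast hq.ratValue_nonneg _)
  have hex : ∀ i : {i : Bool × ℚ // 0 ≤ i.2}, ∃ π : Measure ℝ, IsProbabilityMeasure π ∧
      (∃ B, ∀ᵐ k ∂π, k ∈ Set.Icc 0 B) ∧ (π.prod G.noise).map (fun z => G.nextLevel
        (pricesOfIndex S (S * ratValue δ q (wstar 1 / wstar 0)) i) z.1 z.2) = π := fun i => by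
    obtain ⟨s, hs, a, b, ha, hb⟩ := exists_lattice_pricesOfIndex hS hc i.2
    exact G.exists_stationary_level hs ha hb
  choose π hπ hB hstat using hex
  choose B hB using hB
  have hidx : ∀ w, 0 ≤ (G.priceIndex wstar θ δ q w).2 := fun w => by
    unfold priceIndex
    split_ifs <;> exact hq.ratValue_nonneg _
  let f : ℝ → {i : Bool × ℚ // 0 ≤ i.2} := fun w => ⟨G.priceIndex wstar θ δ q w, hidx w⟩
  have hf : Measurable f := (measurable_priceIndex q).subtype_mk
  let κ : Kernel ℝ ℝ := ⟨fun w => π (f w), (measurable_of_countable π).comp hf⟩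
  refine ⟨κ, fun w => B (f w), measurable_prices hδ S q, (measurable_of_countable B).comp hf,
    ⟨fun w => hπ (f w)⟩, fun w => hB (f w), fun w => ?_⟩
  rw [prices_eq_pricesOfIndex hδ]
  exact hstat (f w)

/-- The long-run share of the participations in which a player facing the prices `p` chooses
resource `0`, as it is forced by a balanced budget. -/
def share (p : Fin 2 → ℝ) : ℝ := -p 1 / (p 0 - p 1)

theorem share_mem_Icc {p : Fin 2 → ℝ} (h0 : 0 ≤ p 0) (h1 : p 1 ≤ 0) (h01 : p 1 < p 0) :
    share p ∈ Set.Icc 0 1 :=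
  ⟨div_nonneg (by linarith) (by linarith), (div_le_one (by linarith)).mpr (by linarith)⟩

theorem measurable_share : Measurable share := by
  unfold share
  fun_prop

theorem abs_inv_one_add_sub_le {x y : ℝ} (hx : 0 ≤ x) (hy : 0 ≤ y) :
    |(1 + x)⁻¹ - (1 + y)⁻¹| ≤ |x - y| := by
  rw [inv_sub_inv (by positivity) (by positivity), abs_div, abs_sub_comm,
    show (1 + x - (1 + y)) = x - y by ring]
  refine div_le_self (abs_nonneg _) ?_
  rw [abs_of_nonneg (by positivity)]
  nlinarith [mul_nonneg hx hy]

/-- The prices are meaningful, and realize the design up to the precision `δ`. -/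
structure RealizesDesign (G : CongestionGame) (wstar : Fin 2 → ℝ) (θ δ : ℝ) (p : Fin 2 → ℝ)
    (w : ℝ) : Prop where
  first_nonneg : 0 ≤ p 0
  second_nonpos : p 1 ≤ 0
  lt : p 1 < p 0
  abs_share_sub_le : |G.Pgo * share p - G.n₁ wstar θ w| ≤ G.Pgo * δ
  share_eq_one : G.n₁ wstar θ w = G.Pgo → share p = 1

/-- In the first case of the prices the share is `(1 + q)⁻¹` with `q` close to `n₂ / n₁`, and
`n₁ = Pgo * (1 + n₂ / n₁)⁻¹`; the second case is the same for resource `1`. The hypothesis `hw`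
excludes the second case for `wstar 1 = 0`, where both prices would vanish. -/
theorem realizesDesign_prices (hopt : G.IsOptimum wstar) (hpos : 0 < wstar 0) (hδ : 0 < δ) {S : ℝ}
    (hS : 0 < S) {q : ℕ → ℚ} (hq : IsRatSeq δ q) {w : ℝ}
    (hw : wstar 0 ≤ G.n₁ wstar θ w ∨ 0 < wstar 1) :
    G.RealizesDesign wstar θ δ (G.prices wstar θ δ S q w) w := by
  have hP := G.Pgo_pos
  have hn := n₁_mem_Icc (G := G) (wstar := wstar) (θ := θ) w
  have hsum := hopt.add_eq
  have hw1 := hopt.1.1 1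
  rw [prices_eq_pricesOfIndex hδ]
  by_cases h : wstar 0 ≤ G.n₁ wstar θ w
  · have hn1 : 0 < G.n₁ wstar θ w := hpos.trans_le h
    have hx : 0 ≤ G.n₂ wstar θ w / G.n₁ wstar θ w := div_nonneg (sub_nonneg.mpr hn.2) hn.1
    have happrox := hq.abs_ratValue_sub_le hδ hx
    have hn₁ : G.n₁ wstar θ w = G.Pgo * (1 + G.n₂ wstar θ w / G.n₁ wstar θ w)⁻¹ := by
      have : 1 + G.n₂ wstar θ w / G.n₁ wstar θ w = G.Pgo / G.n₁ wstar θ w := by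
        rw [n₂]
        field_simp
        ring
      rw [this]
      field_simp
    have hzero : G.n₁ wstar θ w = G.Pgo → G.n₂ wstar θ w / G.n₁ wstar θ w = 0 := fun h' => by
      simp [n₂, h']
    have hidx : G.priceIndex wstar θ δ q w =
      (true, ratValue δ q (G.n₂ wstar θ w / G.n₁ wstar θ w)) := if_pos h
    rw [hidx]
    generalize G.n₂ wstar θ w / G.n₁ wstar θ w = x at *
    have hy : (0 : ℝ) ≤ ratValue δ q x := by exact_mod_cast hq.ratValue_nonneg x
    have hshare : share (pricesOfIndex S (S * ratValue δ q (wstar 1 / wstar 0))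
        (true, ratValue δ q x)) = (1 + (ratValue δ q x : ℝ))⁻¹ := by
      rw [share, pricesOfIndex_true_zero, pricesOfIndex_true_one, neg_neg,
        show ∀ y : ℝ, S * y - -S = S * (1 + y) from fun y => by ring]
      field_simp
    refine ⟨?_, ?_, ?_, ?_, fun h' => ?_⟩
    · rw [pricesOfIndex_true_zero]
      positivity
    · rw [pricesOfIndex_true_one]
      linarith
    · rw [pricesOfIndex_true_zero, pricesOfIndex_true_one]
      nlinarith [mul_nonneg hS.le hy]
    · rw [hshare, hn₁, ← mul_sub, abs_mul, abs_of_pos hP]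
      exact mul_le_mul_of_nonneg_left ((abs_inv_one_add_sub_le hy hx).trans happrox) hP.le
    · rw [hshare, hzero h', ratValue_zero]
      simp
  · have hw1 : 0 < wstar 1 := hw.resolve_left h
    have hn2 : 0 < G.n₂ wstar θ w := by
      rw [n₂]
      linarith
    have hx : 0 ≤ G.n₁ wstar θ w / G.n₂ wstar θ w := div_nonneg hn.1 hn2.le
    have happrox := hq.abs_ratValue_sub_le hδ hx
    have hn₁ : G.n₁ wstar θ w = G.Pgo - G.Pgo * (1 + G.n₁ wstar θ w / G.n₂ wstar θ w)⁻¹ := by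
      have : 1 + G.n₁ wstar θ w / G.n₂ wstar θ w = G.Pgo / G.n₂ wstar θ w := by
        rw [eq_div_iff hn2.ne', add_mul, div_mul_cancel₀ _ hn2.ne', n₂]
        ring
      rw [this, inv_div, mul_div_cancel₀ _ hP.ne', n₂]
      ring
    have hidx : G.priceIndex wstar θ δ q w =
      (false, ratValue δ q (G.n₁ wstar θ w / G.n₂ wstar θ w)) := if_neg h
    have hlt : G.n₁ wstar θ w ≠ G.Pgo := by linarith
    rw [hidx]
    generalize G.n₁ wstar θ w / G.n₂ wstar θ w = x at *
    have hy : (0 : ℝ) ≤ ratValue δ q x := by exact_mod_cast hq.ratValue_nonneg x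
    have hc : 0 < S * (ratValue δ q (wstar 1 / wstar 0) : ℝ) :=
      mul_pos hS (by exact_mod_cast hq.ratValue_pos (div_pos hw1 hpos))
    generalize S * (ratValue δ q (wstar 1 / wstar 0) : ℝ) = c at *
    have hshare : share (pricesOfIndex S c (false, ratValue δ q x)) =
        1 - (1 + (ratValue δ q x : ℝ))⁻¹ := by
      rw [share, pricesOfIndex_false_zero, pricesOfIndex_false_one, neg_neg,
        show ∀ y : ℝ, c - -(c * y) = c * (1 + y) from fun y => by ring]
      field_simp
      ring
    refine ⟨?_, ?_, ?_, ?_, fun h' => absurd h' hlt⟩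
    · rw [pricesOfIndex_false_zero]
      exact hc.le
    · rw [pricesOfIndex_false_one]
      linarith [mul_nonneg hc.le hy]
    · rw [pricesOfIndex_false_zero, pricesOfIndex_false_one]
      linarith [mul_nonneg hc.le hy]
    · rw [hshare, hn₁, show ∀ a b : ℝ, G.Pgo * (1 - a) - (G.Pgo - G.Pgo * b) = G.Pgo * (b - a) from
        fun a b => by ring, abs_mul, abs_of_pos hP, abs_sub_comm]
      exact mul_le_mul_of_nonneg_left ((abs_inv_one_add_sub_le hy hx).trans happrox) hP.le

/-- If the optimum leaves resource `1` empty, the second case of the prices occurs only on a null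
set of weights; otherwise all prices are meaningful. -/
theorem ae_realizesDesign_prices (hopt : G.IsOptimum wstar)
    (hpos : 0 < wstar 0) (hθ : G.IsDesignSolution wstar θ) (hδ : 0 < δ) {S : ℝ} (hS : 0 < S)
    {q : ℕ → ℚ} (hq : IsRatSeq δ q) :
    ∀ᵐ w ∂G.weightLaw, G.RealizesDesign wstar θ δ (G.prices wstar θ δ S q w) w := by
  rcases (hopt.1.1 1).eq_or_lt with h1 | h1
  · have h0 : wstar 0 = G.Pgo := by linarith [hopt.add_eq]
    filter_upwards [hθ.ae_n₁_eq h0] with w hw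
    exact realizesDesign_prices hopt hpos hδ hS hq (Or.inl (h0.trans hw.symm).le)
  · exact Eventually.of_forall fun w => realizesDesign_prices hopt hpos hδ hS hq (Or.inr h1)

end CongestionGame

namespace CongestionGame

/-! ### Aggregates and average latencies of given decision outcomes -/

/-- Summing a function of the chosen resource over time only takes the number of participations and
the number of choices of resource `0`. It applies to payments as well as to latencies. -/
theorem sum_elim_eq (a : ℕ → Option (Fin 2)) (f : Fin 2 → ℝ) (n : ℕ) :
    ∑ τ ∈ Finset.range n, (a τ).elim 0 f =
      (∑ τ ∈ Finset.range n, (a τ).elim 0 fun _ => 1) * f 1 +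
        (∑ τ ∈ Finset.range n, if a τ = some 0 then 1 else 0) * (f 0 - f 1) := by
  rw [Finset.sum_mul, Finset.sum_mul, ← Finset.sum_add_distrib]
  refine Finset.sum_congr rfl fun τ _ => ?_
  rcases a τ with _ | r
  · simp
  · obtain rfl | rfl : r = 0 ∨ r = 1 := by omega
    · simp
    · simp

variable {G : CongestionGame} {Ω : Type*} [MeasurableSpace Ω] {μ : Measure Ω} {W : Ω → ℝ}

theorem agg_congr {a a' : Ω → Option (Fin 2)} (h : a =ᵐ[μ] a') : agg μ W a = agg μ W a' := by
  funext r
  unfold agg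
  congr 1
  refine setIntegral_congr_set ?_
  filter_upwards [h] with ω hω
  change (a ω = some r) = (a' ω = some r)
  rw [hω]

theorem measurable_avgLatency {A : ℕ → Ω → Option (Fin 2)}
    (hA : ∀ t r, MeasurableSet {ω | A t ω = some r}) (t : ℕ) :
    Measurable (G.avgLatency μ W A t) := by
  have helim : ∀ (τ : ℕ) (f : Fin 2 → ℝ), Measurable fun ω => (A τ ω).elim 0 f := by
    intro τ f
    have : (fun ω => (A τ ω).elim 0 f) =
        fun ω => ∑ r, {ω | A τ ω = some r}.indicator (fun _ => f r) ω := by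
      funext ω
      rcases h : A τ ω with _ | r
      · simp [Set.indicator, h]
      · simp [Set.indicator, h]
    rw [this]
    exact Finset.measurable_sum _ fun r _ => measurable_const.indicator (hA τ r)
  unfold avgLatency numPart
  exact (Finset.measurable_sum _ fun τ _ => helim τ _).div
    (Finset.measurable_sum _ fun τ _ => helim τ _)

theorem abs_avgLatency_le {A : ℕ → Ω → Option (Fin 2)} {lat : Fin 2 → ℝ} (h0 : ∀ r, 0 ≤ lat r)
    (hlat : ∀ t r, G.l r (agg μ W (A t) r) = lat r) (t : ℕ) (ω : Ω) :
    |G.avgLatency μ W A t ω| ≤ lat 0 + lat 1 := by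
  have hle : ∀ a : Option (Fin 2), 0 ≤ a.elim 0 lat ∧ 0 ≤ a.elim 0 (fun _ => (1 : ℝ)) ∧
      a.elim 0 lat ≤ (lat 0 + lat 1) * a.elim 0 fun _ => (1 : ℝ) := by
    rintro (_ | r)
    · simp
    · obtain rfl | rfl : r = 0 ∨ r = 1 := by omega
      · simp [h0]
      · simp [h0]
  have hN : 0 ≤ numPart A t ω := Finset.sum_nonneg fun τ _ => (hle _).2.1
  unfold avgLatency
  simp only [hlat]
  change |(∑ τ ∈ Finset.range (t + 1), (A τ ω).elim 0 lat) / _| ≤ _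
  rw [abs_of_nonneg (div_nonneg (Finset.sum_nonneg fun τ _ => (hle _).1) hN)]
  refine div_le_of_le_mul₀ hN (add_nonneg (h0 0) (h0 1)) ?_
  rw [numPart, Finset.mul_sum]
  exact Finset.sum_le_sum fun τ _ => (hle _).2.2

end CongestionGame

namespace CongestionGame

/-! ### The canonical trajectory -/

variable (G : CongestionGame)

/-- The levels of a player who always follows `decision`, as a function of the weight and the
initial level `z` and of the sequence `e` of participations and urgencies. -/
def levelPath (p : ℝ → Fin 2 → ℝ) (z : ℝ × ℝ) (e : ℕ → Bool × ℝ) : ℕ → ℝ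
  | 0 => z.2
  | t + 1 => G.nextLevel (p z.1) (levelPath p z e t) (e t)

variable {Ω : Type*}

/-- The levels in a population in which all players follow `decision`. -/
def level (p : ℝ → Fin 2 → ℝ) (W K₀ : Ω → ℝ) (P : ℕ → Ω → Bool) (U : ℕ → Ω → ℝ) (t : ℕ) (ω : Ω) :
    ℝ :=
  G.levelPath p (W ω, K₀ ω) (fun s => (P s ω, U s ω)) t

/-- The decision outcomes in a population in which all players follow `decision`. -/
def play (p : ℝ → Fin 2 → ℝ) (W K₀ : Ω → ℝ) (P : ℕ → Ω → Bool) (U : ℕ → Ω → ℝ) (t : ℕ) (ω : Ω) :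
    Option (Fin 2) :=
  if P t ω = true then some (G.decision (p (W ω)) (G.level p W K₀ P U t ω) (U t ω)) else none

variable {G} {p : ℝ → Fin 2 → ℝ} {κ : Kernel ℝ ℝ} {B : ℝ → ℝ} {W K₀ : Ω → ℝ} {P : ℕ → Ω → Bool}
  {U : ℕ → Ω → ℝ}

theorem level_zero (ω : Ω) : G.level p W K₀ P U 0 ω = K₀ ω := rfl

theorem level_succ (t : ℕ) (ω : Ω) : G.level p W K₀ P U (t + 1) ω =
    G.nextLevel (p (W ω)) (G.level p W K₀ P U t ω) (P t ω, U t ω) := rfl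

theorem level_succ_eq_sub (t : ℕ) (ω : Ω) : G.level p W K₀ P U (t + 1) ω =
    G.level p W K₀ P U t ω - (G.play p W K₀ P U t ω).elim 0 (p (W ω)) := by
  rw [level_succ, nextLevel, play]
  split_ifs <;> simp

theorem acLevel_play (t : ℕ) (ω : Ω) :
    acLevel p W K₀ (G.play p W K₀ P U) t ω = G.level p W K₀ P U t ω := by
  induction t with
  | zero => rfl
  | succ t ih => rw [acLevel, ih, level_succ_eq_sub]

theorem play_eq_some_iff (t : ℕ) (ω : Ω) (r : Fin 2) : G.play p W K₀ P U t ω = some r ↔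
    P t ω = true ∧ G.decision (p (W ω)) (G.level p W K₀ P U t ω) (U t ω) = r := by
  unfold play
  split_ifs with h <;> simp [h]

theorem levelPath_congr (z : ℝ × ℝ) {e e' : ℕ → Bool × ℝ} {t : ℕ} (h : ∀ s < t, e s = e' s) :
    G.levelPath p z e t = G.levelPath p z e' t := by
  induction t with
  | zero => rfl
  | succ t ih => rw [levelPath, levelPath, ih fun s hs => h s (by omega), h t (by omega)]

theorem measurable_levelPath (hp : Measurable p) (t : ℕ) :
    Measurable fun x : (ℝ × ℝ) × (ℕ → Bool × ℝ) => G.levelPath p x.1 x.2 t := by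
  induction t with
  | zero => exact (by fun_prop : Measurable fun x : (ℝ × ℝ) × (ℕ → Bool × ℝ) => x.1.2)
  | succ t ih =>
    exact G.measurable_nextLevel.comp
      ((hp.comp (by fun_prop : Measurable fun x : (ℝ × ℝ) × (ℕ → Bool × ℝ) => x.1.1)).prodMk
        (ih.prodMk (by fun_prop : Measurable fun x : (ℝ × ℝ) × (ℕ → Bool × ℝ) => x.2 t)))

theorem level_eq_sub_sum (t : ℕ) (ω : Ω) : G.level p W K₀ P U t ω =
    K₀ ω - ∑ τ ∈ Finset.range t, (G.play p W K₀ P U τ ω).elim 0 (p (W ω)) := by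
  induction t with
  | zero => simp [level_zero]
  | succ t ih =>
    rw [Finset.sum_range_succ, level_succ_eq_sub, ih]
    ring

/-! ### Weights, levels and participation in a population -/

variable [MeasurableSpace Ω] {μ : Measure Ω} {init : Measure (ℝ × ℝ)}

theorem IsPopulation.measurable_noise (hpop : G.IsPopulation μ init W K₀ P U) (t : ℕ) :
    Measurable fun ω => (P t ω, U t ω) :=
  (hpop.measurable_P t).prodMk (hpop.measurable_U t)

theorem IsPopulation.map_weight (hκ : G.IsStationaryKernel p κ B)
    (hpop : G.IsPopulation μ (G.weightLaw ⊗ₘ κ) W K₀ P U) : μ.map W = G.weightLaw := by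
  have := hκ.markov
  have h : W = Prod.fst ∘ fun ω => (W ω, K₀ ω) := rfl
  rw [h, ← Measure.map_map measurable_fst (hpop.measurable_W.prodMk hpop.measurable_K₀),
    hpop.law_init]
  exact Measure.fst_compProd _ _

theorem IsPopulation.measurable_level (hp : Measurable p) (hpop : G.IsPopulation μ init W K₀ P U)
    (t : ℕ) : Measurable (G.level p W K₀ P U t) :=
  (measurable_levelPath hp t).comp ((hpop.measurable_W.prodMk hpop.measurable_K₀).prodMk
    (measurable_pi_lambda _ hpop.measurable_noise))

theorem IsPopulation.ae_weight (hκ : G.IsStationaryKernel p κ B)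
    (hpop : G.IsPopulation μ (G.weightLaw ⊗ₘ κ) W K₀ P U) {q : ℝ → Prop}
    (hq : ∀ᵐ w ∂G.weightLaw, q w) : ∀ᵐ ω ∂μ, q (W ω) := by
  rw [← hpop.map_weight hκ] at hq
  exact ae_of_ae_map hpop.measurable_W.aemeasurable hq

theorem IsPopulation.mean_weight (hκ : G.IsStationaryKernel p κ B)
    (hpop : G.IsPopulation μ (G.weightLaw ⊗ₘ κ) W K₀ P U) :
    ∫ ω, W ω ∂μ = ∫ w, w ∂G.weightLaw := by
  conv_rhs => rw [← hpop.map_weight hκ]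
  exact (integral_map hpop.measurable_W.aemeasurable measurable_id.aestronglyMeasurable).symm

theorem IsPopulation.measurableSet_play (hp : Measurable p)
    (hpop : G.IsPopulation μ init W K₀ P U) (t : ℕ) (r : Fin 2) :
    MeasurableSet {ω | G.play p W K₀ P U t ω = some r} := by
  have : {ω | G.play p W K₀ P U t ω = some r} = P t ⁻¹' {true} ∩
      (fun ω => G.decision (p (W ω)) (G.level p W K₀ P U t ω) (U t ω)) ⁻¹' {r} := by
    ext ω
    exact play_eq_some_iff t ω r
  rw [this]
  refine (hpop.measurable_P t (measurableSet_singleton true)).inter ?_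
  exact G.measurable_decision.comp ((hp.comp hpop.measurable_W).prodMk
    ((hpop.measurable_level hp t).prodMk (hpop.measurable_U t))) (measurableSet_singleton r)

theorem IsPopulation.agg_play_add (hκ : G.IsStationaryKernel p κ B)
    (hpop : G.IsPopulation μ (G.weightLaw ⊗ₘ κ) W K₀ P U) (t : ℕ) :
    agg μ W (G.play p W K₀ P U t) 0 + agg μ W (G.play p W K₀ P U t) 1 = G.Pgo := by
  have := hκ.markov
  have hW : Integrable W μ := by
    have h := integrable_weight (G := G)
    rw [← hpop.map_weight hκ] at h
    exact h.comp_measurable hpop.measurable_W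
  have hunion : {ω | G.play p W K₀ P U t ω = some 0} ∪ {ω | G.play p W K₀ P U t ω = some 1} =
      P t ⁻¹' {true} := by
    ext ω
    simp only [Set.mem_union, Set.mem_ofPred_eq, play_eq_some_iff, Set.mem_preimage,
      Set.mem_singleton_iff, ← and_or_left, and_iff_left_iff_imp]
    omega
  have hdisj : Disjoint {ω | G.play p W K₀ P U t ω = some 0}
      {ω | G.play p W K₀ P U t ω = some 1} := by
    rw [Set.disjoint_left]
    intro ω h0 h1
    simp only [Set.mem_ofPred_eq] at h0 h1
    rw [h0] at h1
    simp at h1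
  have hind : IndepFun W (P t) μ :=
    hpop.indep_init.comp (φ := Prod.fst) (ψ := fun e : ℕ → Bool × ℝ => (e t).1)
      measurable_fst (by fun_prop)
  have hPm : MeasurableSet (P t ⁻¹' {true}) := hpop.measurable_P t (measurableSet_singleton true)
  have hind' : IndepFun W ((P t ⁻¹' {true}).indicator fun _ => (1 : ℝ)) μ :=
    hind.comp (φ := id) (ψ := ({true} : Set Bool).indicator fun _ => (1 : ℝ)) measurable_id
      (measurable_of_countable _)
  have hmean : ∫ ω in P t ⁻¹' {true}, W ω ∂μ = (∫ ω, W ω ∂μ) * G.Pgo := by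
    have h := hind'.integral_fun_mul_eq_mul_integral hpop.measurable_W.aestronglyMeasurable
      (measurable_const.indicator hPm).aestronglyMeasurable
    rw [integral_indicator_const _ hPm, Measure.real, show μ (P t ⁻¹' {true}) = _ from
      hpop.law_P t, ENNReal.toReal_ofReal G.Pgo_pos.le, smul_eq_mul, mul_one] at h
    rw [← h, ← integral_indicator hPm]
    refine integral_congr_ae (Eventually.of_forall fun ω => ?_)
    by_cases hω : ω ∈ P t ⁻¹' {true} <;> simp [hω]
  rw [agg, agg, ← add_div, ← setIntegral_union hdisj
    (hpop.measurableSet_play hκ.measurable_prices t 1) hW.integrableOn hW.integrableOn, hunion,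
    hmean, mul_div_cancel_left₀]
  rw [hpop.mean_weight hκ]
  exact mean_weight_pos.ne'

variable [IsProbabilityMeasure μ]

theorem IsPopulation.map_participation (hpop : G.IsPopulation μ init W K₀ P U) (t : ℕ) :
    μ.map (P t) = G.participationLaw := by
  have hm := hpop.measurable_P t
  have htrue : μ (P t ⁻¹' {true}) = ENNReal.ofReal G.Pgo := hpop.law_P t
  have hset : P t ⁻¹' {false} = (P t ⁻¹' {true})ᶜ := by ext; simp
  refine Measure.ext_of_singleton fun b => ?_
  rw [Measure.map_apply hm (measurableSet_singleton b)]
  cases b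
  · rw [hset, prob_compl_eq_one_sub (hm (measurableSet_singleton true)), htrue, participationLaw,
      ← ENNReal.ofReal_one, ← ENNReal.ofReal_sub _ G.Pgo_pos.le]
    simp
  · rw [htrue]
    simp [participationLaw]

theorem IsPopulation.map_noise (hpop : G.IsPopulation μ init W K₀ P U) (t : ℕ) :
    μ.map (fun ω => (P t ω, U t ω)) = G.noise := by
  have h := (indepFun_iff_map_prod_eq_prod_map_map (hpop.measurable_P t).aemeasurable
    (hpop.measurable_U t).aemeasurable).mp (hpop.indep_PU t)
  rw [h, hpop.map_participation, hpop.law_U, noise]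

/-- Weight and current level depend on the past only, so they are independent of the present
participation and urgency. -/
theorem IsPopulation.indepFun_level (hp : Measurable p) (hpop : G.IsPopulation μ init W K₀ P U)
    (t : ℕ) : IndepFun (fun ω => (W ω, G.level p W K₀ P U t ω)) (fun ω => (P t ω, U t ω)) μ := by
  let X : Ω → ℝ × ℝ := fun ω => (W ω, K₀ ω)
  let Y : Ω → (Finset.range t → Bool × ℝ) := fun ω s => (P s ω, U s ω)
  have hX : Measurable X := hpop.measurable_W.prodMk hpop.measurable_K₀
  have hY : Measurable Y := measurable_pi_lambda _ fun s => hpop.measurable_noise s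
  have hXYZ : IndepFun X (fun ω => (Y ω, (P t ω, U t ω))) μ :=
    hpop.indep_init.comp (φ := id)
      (ψ := fun e : ℕ → Bool × ℝ => ((fun s => e s : Finset.range t → Bool × ℝ), e t))
      measurable_id (by fun_prop)
  have hYZ : IndepFun Y (fun ω => (P t ω, U t ω)) μ :=
    (hpop.indep_time.indepFun_finset (Finset.range t) {t} (by simp) hpop.measurable_noise).comp
      (φ := id) (ψ := fun e : ({t} : Finset ℕ) → Bool × ℝ => e ⟨t, by simp⟩) measurable_id
      (measurable_pi_apply _)
  have hXY := IndepFun.prodMk_left_of_prodMk_right hX hY (hpop.measurable_noise t) hXYZ hYZ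
  -- complete the past by an arbitrary future
  let ext : (Finset.range t → Bool × ℝ) → ℕ → Bool × ℝ := fun y s =>
    if h : s ∈ Finset.range t then y ⟨s, h⟩ else (false, 0)
  have hext : Measurable ext := measurable_pi_lambda _ fun s => by
    by_cases h : s ∈ Finset.range t
    · simp only [ext, dif_pos h]
      exact measurable_pi_apply _
    · simp only [ext, dif_neg h]
      exact measurable_const
  have hlevel : (fun ω => (W ω, G.level p W K₀ P U t ω)) =
      (fun x : (ℝ × ℝ) × (Finset.range t → Bool × ℝ) =>
        (x.1.1, G.levelPath p x.1 (ext x.2) t)) ∘ fun ω => (X ω, Y ω) := by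
    funext ω
    refine Prod.ext rfl (levelPath_congr _ fun s hs => ?_)
    simp [ext, hs, Y]
  rw [hlevel]
  refine hXY.comp (φ := fun x : (ℝ × ℝ) × (Finset.range t → Bool × ℝ) =>
    (x.1.1, G.levelPath p x.1 (ext x.2) t)) (ψ := id) ?_ measurable_id
  exact (by fun_prop : Measurable fun x : (ℝ × ℝ) × (Finset.range t → Bool × ℝ) => x.1.1).prodMk
    ((measurable_levelPath hp t).comp (measurable_fst.prodMk (hext.comp measurable_snd)))

/-! ### Stationarity of the population -/

theorem IsStationaryKernel.measurable_next (hκ : G.IsStationaryKernel p κ B) :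
    Measurable fun z : (ℝ × ℝ) × (Bool × ℝ) => G.nextLevel (p z.1.1) z.1.2 z.2 :=
  G.measurable_nextLevel.comp ((hκ.measurable_prices.comp
    (by fun_prop : Measurable fun z : (ℝ × ℝ) × (Bool × ℝ) => z.1.1)).prodMk
    (by fun_prop : Measurable fun z : (ℝ × ℝ) × (Bool × ℝ) => (z.1.2, z.2)))

theorem IsStationaryKernel.map_next (hκ : G.IsStationaryKernel p κ B) :
    (((G.weightLaw ⊗ₘ κ).prod G.noise).map
      fun z => (z.1.1, G.nextLevel (p z.1.1) z.1.2 z.2)) = G.weightLaw ⊗ₘ κ := by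
  have := hκ.markov
  have hm := hκ.measurable_next
  have hpair : Measurable fun z : (ℝ × ℝ) × (Bool × ℝ) =>
      (z.1.1, G.nextLevel (p z.1.1) z.1.2 z.2) :=
    (by fun_prop : Measurable fun z : (ℝ × ℝ) × (Bool × ℝ) => z.1.1).prodMk hm
  refine Measure.ext_of_lintegral _ fun f hf => ?_
  let h : (ℝ × ℝ) × (Bool × ℝ) → ENNReal :=
    fun z => f (z.1.1, G.nextLevel (p z.1.1) z.1.2 z.2)
  have hh : Measurable h := hf.comp hpair
  rw [lintegral_map hf hpair, lintegral_prod h hh.aemeasurable,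
    Measure.lintegral_compProd (f := fun x => ∫⁻ e, h (x, e) ∂G.noise) hh.lintegral_prod_right',
    Measure.lintegral_compProd hf]
  refine lintegral_congr fun w => ?_
  have hmw : Measurable fun z : ℝ × (Bool × ℝ) => G.nextLevel (p w) z.1 z.2 :=
    hm.comp (by fun_prop : Measurable fun z : ℝ × (Bool × ℝ) => ((w, z.1), z.2))
  have hfw : Measurable fun k => f (w, k) := hf.comp measurable_prodMk_left
  conv_rhs => rw [← hκ.stationary w]
  rw [lintegral_map hfw hmw,
    lintegral_prod (fun z => f (w, G.nextLevel (p w) z.1 z.2)) (hfw.comp hmw).aemeasurable]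

theorem IsPopulation.map_weight_level (hκ : G.IsStationaryKernel p κ B)
    (hpop : G.IsPopulation μ (G.weightLaw ⊗ₘ κ) W K₀ P U) (t : ℕ) :
    μ.map (fun ω => (W ω, G.level p W K₀ P U t ω)) = G.weightLaw ⊗ₘ κ := by
  induction t with
  | zero => exact hpop.law_init
  | succ t ih =>
    have hWL := hpop.measurable_W.prodMk (hpop.measurable_level hκ.measurable_prices t)
    have hjoint := (indepFun_iff_map_prod_eq_prod_map_map hWL.aemeasurable
      (hpop.measurable_noise t).aemeasurable).mp (hpop.indepFun_level hκ.measurable_prices t)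
    rw [ih, hpop.map_noise] at hjoint
    conv_rhs => rw [← hκ.map_next, ← hjoint]
    rw [Measure.map_map ((by fun_prop : Measurable fun z : (ℝ × ℝ) × (Bool × ℝ) =>
      z.1.1).prodMk hκ.measurable_next) (hWL.prodMk (hpop.measurable_noise t))]
    rfl

/-- Weights, levels, participations and urgencies have the same joint law at every time. -/
theorem IsPopulation.map_weight_level_noise (hκ : G.IsStationaryKernel p κ B)
    (hpop : G.IsPopulation μ (G.weightLaw ⊗ₘ κ) W K₀ P U) (t : ℕ) :
    μ.map (fun ω => ((W ω, G.level p W K₀ P U t ω), (P t ω, U t ω))) =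
      (G.weightLaw ⊗ₘ κ).prod G.noise := by
  have hWL := hpop.measurable_W.prodMk (hpop.measurable_level hκ.measurable_prices t)
  rw [(indepFun_iff_map_prod_eq_prod_map_map hWL.aemeasurable
    (hpop.measurable_noise t).aemeasurable).mp (hpop.indepFun_level hκ.measurable_prices t),
    hpop.map_weight_level hκ, hpop.map_noise]

theorem IsPopulation.ae_level_mem (hκ : G.IsStationaryKernel p κ B)
    (hpop : G.IsPopulation μ (G.weightLaw ⊗ₘ κ) W K₀ P U) (t : ℕ) :
    ∀ᵐ ω ∂μ, G.level p W K₀ P U t ω ∈ Set.Icc 0 (B (W ω)) := by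
  have := hκ.markov
  have hset : MeasurableSet {z : ℝ × ℝ | z.2 ∈ Set.Icc 0 (B z.1)} :=
    (measurableSet_le measurable_const measurable_snd).inter
      (measurableSet_le measurable_snd (hκ.measurable_bound.comp measurable_fst))
  have h : ∀ᵐ z ∂(G.weightLaw ⊗ₘ κ), z.2 ∈ Set.Icc 0 (B z.1) :=
    (Measure.ae_compProd_iff hset).mpr (Eventually.of_forall hκ.bounded)
  rw [← hpop.map_weight_level hκ t] at h
  exact ae_of_ae_map (hpop.measurable_W.prodMk
    (hpop.measurable_level hκ.measurable_prices t)).aemeasurable h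

/-- Ties have probability zero, because the urgency is atomless and independent of the level. -/
theorem IsPopulation.ae_urgency_ne_threshold (hκ : G.IsStationaryKernel p κ B)
    (hpop : G.IsPopulation μ (G.weightLaw ⊗ₘ κ) W K₀ P U) (t : ℕ) :
    ∀ᵐ ω ∂μ, U t ω ≠ G.threshold (p (W ω)) (G.level p W K₀ P U t ω) := by
  have := hκ.markov
  have := G.urgency_noAtoms
  have hthr : Measurable fun z : (ℝ × ℝ) × (Bool × ℝ) => G.threshold (p z.1.1) z.1.2 :=
    G.measurable_threshold.comp ((hκ.measurable_prices.comp
      (by fun_prop : Measurable fun z : (ℝ × ℝ) × (Bool × ℝ) => z.1.1)).prodMk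
      (by fun_prop : Measurable fun z : (ℝ × ℝ) × (Bool × ℝ) => z.1.2))
  have hset : MeasurableSet {z : (ℝ × ℝ) × (Bool × ℝ) | z.2.2 ≠ G.threshold (p z.1.1) z.1.2} :=
    (measurableSet_eq_fun (by fun_prop) hthr).compl
  have h : ∀ᵐ z ∂((G.weightLaw ⊗ₘ κ).prod G.noise), z.2.2 ≠ G.threshold (p z.1.1) z.1.2 := by
    rw [Measure.ae_prod_iff_ae_ae hset]
    exact Eventually.of_forall fun x => G.ae_noise_of_ae_urgencyLaw
      (s := {u | u ≠ G.threshold (p x.1) x.2}) (Measure.ae_ne _ _)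
  rw [← hpop.map_weight_level_noise hκ t] at h
  exact ae_of_ae_map ((hpop.measurable_W.prodMk
    (hpop.measurable_level hκ.measurable_prices t)).prodMk
      (hpop.measurable_noise t)).aemeasurable h

/-- The aggregate of resource `0` when each weight class chooses it at the rate forced by a
balanced budget. -/
def stationaryAgg (G : CongestionGame) (p : ℝ → Fin 2 → ℝ) : ℝ :=
  (∫ w, G.Pgo * share (p w) * w ∂G.weightLaw) / ∫ w, w ∂G.weightLaw

theorem integrable_fst_compProd_prod (hκ : G.IsStationaryKernel p κ B) :
    Integrable (fun z : (ℝ × ℝ) × (Bool × ℝ) => z.1.1) ((G.weightLaw ⊗ₘ κ).prod G.noise) := by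
  have := hκ.markov
  have h : Integrable (fun z : ℝ × ℝ => z.1) (G.weightLaw ⊗ₘ κ) := by
    have h' := integrable_weight (G := G)
    rw [← Measure.fst_compProd G.weightLaw κ, Measure.fst] at h'
    exact h'.comp_measurable measurable_fst
  exact h.comp_fst _

/-- Conditionally on the weight, the level is stationary, so `stationary_rate` applies to each
weight class. -/
theorem IsPopulation.agg_play_zero (hκ : G.IsStationaryKernel p κ B)
    (hpop : G.IsPopulation μ (G.weightLaw ⊗ₘ κ) W K₀ P U)
    (hp01 : ∀ᵐ w ∂G.weightLaw, p w 1 < p w 0) (t : ℕ) :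
    agg μ W (G.play p W K₀ P U t) 0 = G.stationaryAgg p := by
  have := hκ.markov
  have hdec : Measurable fun z : (ℝ × ℝ) × (Bool × ℝ) => G.decision (p z.1.1) z.1.2 z.2.2 :=
    G.measurable_decision.comp ((hκ.measurable_prices.comp
      (by fun_prop : Measurable fun z : (ℝ × ℝ) × (Bool × ℝ) => z.1.1)).prodMk
      (by fun_prop : Measurable fun z : (ℝ × ℝ) × (Bool × ℝ) => (z.1.2, z.2.2)))
  let s : Set ((ℝ × ℝ) × (Bool × ℝ)) := {z | (z.1.2, z.2) ∈ G.choosesFirst (p z.1.1)}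
  have hs : MeasurableSet s :=
    ((by fun_prop : Measurable fun z : (ℝ × ℝ) × (Bool × ℝ) => z.2.1)
      (measurableSet_singleton true)).inter (hdec (measurableSet_singleton 0))
  have hint := (integrable_fst_compProd_prod hκ).indicator hs
  have hpush : ∫ ω in {ω | G.play p W K₀ P U t ω = some 0}, W ω ∂μ =
      ∫ z, s.indicator (fun z => z.1.1) z ∂((G.weightLaw ⊗ₘ κ).prod G.noise) := by
    rw [← hpop.map_weight_level_noise hκ t, integral_map ((hpop.measurable_W.prodMk
      (hpop.measurable_level hκ.measurable_prices t)).prodMk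
        (hpop.measurable_noise t)).aemeasurable
      (Measurable.indicator (by fun_prop) hs).aestronglyMeasurable,
      ← integral_indicator (hpop.measurableSet_play hκ.measurable_prices t 0)]
    refine integral_congr_ae (Eventually.of_forall fun ω => ?_)
    have : ω ∈ {ω | G.play p W K₀ P U t ω = some 0} ↔
        ((W ω, G.level p W K₀ P U t ω), (P t ω, U t ω)) ∈ s := play_eq_some_iff t ω 0
    by_cases hω : ω ∈ {ω | G.play p W K₀ P U t ω = some 0}
    · simp only [Set.indicator_of_mem hω, Set.indicator_of_mem (this.mp hω)]
    · simp only [Set.indicator_of_notMem hω, Set.indicator_of_notMem fun h => hω (this.mpr h)]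
  rw [agg, stationaryAgg, hpop.mean_weight hκ, hpush, integral_prod _ hint,
    Measure.integral_compProd hint.integral_prod_left]
  congr 1
  refine integral_congr_ae ?_
  filter_upwards [hp01] with w hw
  have hslice : ∀ k e, s.indicator (fun z => z.1.1) ((w, k), e) =
      (G.choosesFirst (p w)).indicator (fun _ => w) (k, e) := fun _ _ => rfl
  have hrate := G.stationary_rate (hκ.bounded w) (hκ.stationary w)
  have hd : p w 0 - p w 1 ≠ 0 := by linarith
  simp only [hslice]
  rw [← integral_prod _ ((integrable_const w).indicator (G.measurableSet_choosesFirst (p w))),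
    integral_indicator_const _ (G.measurableSet_choosesFirst (p w)), smul_eq_mul,
    eq_div_of_mul_eq hd hrate, share]
  ring

/-! ### Existence and uniqueness of the equilibria -/

/-- As long as resource `0` is faster, following `decision` is an equilibrium. -/
theorem IsPopulation.isNashTrajectory_play (hκ : G.IsStationaryKernel p κ B)
    (hpop : G.IsPopulation μ (G.weightLaw ⊗ₘ κ) W K₀ P U)
    (hp : ∀ᵐ w ∂G.weightLaw, p w 1 ≤ 0 ∧ p w 1 < p w 0)
    (hfast : G.FirstFaster μ W (G.play p W K₀ P U)) :
    G.IsNashTrajectory μ p W K₀ P U (G.play p W K₀ P U) := by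
  intro t
  refine ⟨hpop.measurableSet_play hκ.measurable_prices t, ?_⟩
  filter_upwards [hpop.ae_weight hκ hp, hpop.ae_level_mem hκ t,
    hpop.ae_urgency_ne_threshold hκ t] with ω h1 h2 h3
  rw [acLevel_play]
  refine ⟨fun h => by simp [play, h], fun h => ⟨_, by rw [play, if_pos h], ?_⟩⟩
  exact (G.isBestResponse_iff_eq_decision h1.1 h1.2 h2.1 (hfast t) h3 _).mpr rfl

/-- Every equilibrium in which resource `0` is always faster agrees almost everywhere with
`play`. -/
theorem IsPopulation.ae_eq_play (hκ : G.IsStationaryKernel p κ B)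
    (hpop : G.IsPopulation μ (G.weightLaw ⊗ₘ κ) W K₀ P U)
    (hp : ∀ᵐ w ∂G.weightLaw, p w 1 ≤ 0 ∧ p w 1 < p w 0) {A : ℕ → Ω → Option (Fin 2)}
    (hA : G.IsNashTrajectory μ p W K₀ P U A) (hfast : G.FirstFaster μ W A) (t : ℕ) :
    A t =ᵐ[μ] G.play p W K₀ P U t := by
  have hstep : ∀ t, (∀ᵐ ω ∂μ, acLevel p W K₀ A t ω = G.level p W K₀ P U t ω) →
      A t =ᵐ[μ] G.play p W K₀ P U t := by
    intro t ht
    filter_upwards [ht, (hA t).2, hpop.ae_weight hκ hp, hpop.ae_level_mem hκ t,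
      hpop.ae_urgency_ne_threshold hκ t] with ω h0 hN h1 h2 h3
    rw [h0] at hN
    cases hP : P t ω
    · rw [hN.1 hP, play, if_neg (by simp [hP])]
    · obtain ⟨r, hr, hbr⟩ := hN.2 hP
      rw [hr, play, if_pos hP,
        (G.isBestResponse_iff_eq_decision h1.1 h1.2 h2.1 (hfast t) h3 r).mp hbr]
  have hlevel : ∀ t, ∀ᵐ ω ∂μ, acLevel p W K₀ A t ω = G.level p W K₀ P U t ω := by
    intro t
    induction t with
    | zero => exact Eventually.of_forall fun ω => rfl
    | succ t ih =>
      filter_upwards [ih, hstep t ih] with ω h1 h2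
      rw [acLevel, h1, h2, level_succ_eq_sub]
  exact hstep t (hlevel t)

/-! ### The perceived latencies in the long run -/

theorem IsPopulation.ae_tendsto_numPart (hpop : G.IsPopulation μ init W K₀ P U)
    {A : ℕ → Ω → Option (Fin 2)} (hA : ∀ t, A t =ᵐ[μ] G.play p W K₀ P U t) :
    ∀ᵐ ω ∂μ, Tendsto (fun t => numPart A t ω) atTop atTop := by
  let f : Bool → ℝ := fun b => if b = true then 1 else 0
  have hf : Measurable f := measurable_of_countable f
  let X : ℕ → Ω → ℝ := fun t ω => f (P t ω)
  have hXm : ∀ t, Measurable (X t) := fun t => hf.comp (hpop.measurable_P t)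
  have hXb : ∀ t ω, ‖X t ω‖ ≤ 1 := fun t ω => by
    simp only [X, f]
    split_ifs <;> simp
  have hXind : X 0 = (P 0 ⁻¹' {true}).indicator fun _ => (1 : ℝ) := by
    funext ω
    by_cases h : P 0 ω = true <;> simp [X, f, h]
  have hmean : ∫ ω, X 0 ω ∂μ = G.Pgo := by
    rw [hXind, integral_indicator_const _ (hpop.measurable_P 0 (measurableSet_singleton true)),
      Measure.real, show μ (P 0 ⁻¹' {true}) = _ from hpop.law_P 0,
      ENNReal.toReal_ofReal G.Pgo_pos.le, smul_eq_mul, mul_one]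
  have hlaw := strong_law_ae_real X
    (Integrable.of_bound (hXm 0).aestronglyMeasurable 1 (Eventually.of_forall (hXb 0)))
    (fun i j hij => (hpop.indep_time.indepFun hij).comp (φ := fun e : Bool × ℝ => f e.1)
      (ψ := fun e : Bool × ℝ => f e.1) (hf.comp measurable_fst) (hf.comp measurable_fst))
    (fun i => (IdentDistrib.mk (hpop.measurable_P i).aemeasurable (hpop.measurable_P 0).aemeasurable
      ((hpop.map_participation i).trans (hpop.map_participation 0).symm)).comp hf)
  rw [hmean] at hlaw
  filter_upwards [hlaw, ae_all_iff.mpr hA] with ω hω hAω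
  have h1 : Tendsto (fun n : ℕ => ∑ i ∈ Finset.range n, X i ω) atTop atTop := by
    refine (hω.pos_mul_atTop G.Pgo_pos tendsto_natCast_atTop_atTop).congr' ?_
    filter_upwards [eventually_ne_atTop 0] with n hn
    exact div_mul_cancel₀ _ (Nat.cast_ne_zero.mpr hn)
  refine (h1.comp (tendsto_add_atTop_nat 1)).congr fun t => ?_
  refine Finset.sum_congr rfl fun i _ => ?_
  rw [hAω i, play]
  by_cases h : P i ω = true <;> simp [X, f, h]

/-- Since the level of a player is bounded, the payments balance in the long run, and the average
perceived latency converges to the one prescribed by `share`. -/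
theorem IsPopulation.ae_tendsto_avgLatency (hκ : G.IsStationaryKernel p κ B)
    (hpop : G.IsPopulation μ (G.weightLaw ⊗ₘ κ) W K₀ P U)
    (hp : ∀ᵐ w ∂G.weightLaw, p w 1 < p w 0) {A : ℕ → Ω → Option (Fin 2)}
    (hA : ∀ t, A t =ᵐ[μ] G.play p W K₀ P U t) {lat : Fin 2 → ℝ}
    (hlat : ∀ t r, G.l r (agg μ W (A t) r) = lat r) :
    ∀ᵐ ω ∂μ, Tendsto (fun t => G.avgLatency μ W A t ω) atTop
      (𝓝 (lat 1 + share (p (W ω)) * (lat 0 - lat 1))) := by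
  filter_upwards [hpop.ae_tendsto_numPart hA, hpop.ae_weight hκ hp, ae_all_iff.mpr hA,
    ae_all_iff.mpr (hpop.ae_level_mem hκ)] with ω hN h01 hAω hK
  have hd : p (W ω) 0 - p (W ω) 1 ≠ 0 := by linarith
  have hform : ∀ᶠ t in atTop, G.avgLatency μ W A t ω = lat 1 + (share (p (W ω)) +
      (K₀ ω - G.level p W K₀ P U (t + 1) ω) / (numPart A t ω) / (p (W ω) 0 - p (W ω) 1)) *
        (lat 0 - lat 1) := by
    filter_upwards [hN.eventually_gt_atTop 0] with t ht
    have hpay := sum_elim_eq (fun τ => A τ ω) (p (W ω)) (t + 1)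
    have hlev := level_eq_sub_sum (G := G) (p := p) (W := W) (K₀ := K₀) (P := P) (U := U) (t + 1) ω
    simp only [← hAω] at hlev
    rw [hpay] at hlev
    have hsum := sum_elim_eq (fun τ => A τ ω) lat (t + 1)
    unfold avgLatency
    simp only [hlat]
    have hNdef : ∑ τ ∈ Finset.range (t + 1), (A τ ω).elim 0 (fun _ => (1 : ℝ)) = numPart A t ω :=
      rfl
    rw [hNdef] at hlev hsum
    change (∑ τ ∈ Finset.range (t + 1), (A τ ω).elim 0 lat) / _ = _
    rw [hsum, hlev, share]
    field_simp
    ring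
  refine Tendsto.congr' (EventuallyEq.symm hform) ?_
  have hbd : Tendsto (fun t => (K₀ ω - G.level p W K₀ P U (t + 1) ω) / numPart A t ω) atTop
      (𝓝 0) := by
    refine squeeze_zero_norm' ?_ (tendsto_const_nhds.div_atTop hN : Tendsto
      (fun t => B (W ω) / numPart A t ω) atTop (𝓝 0))
    filter_upwards [hN.eventually_gt_atTop 0] with t ht
    rw [Real.norm_eq_abs, abs_div, abs_of_pos ht]
    refine div_le_div_of_nonneg_right ?_ ht.le
    have h0 := hK 0
    rw [level_zero] at h0
    exact abs_le.mpr ⟨by linarith [h0.1, (hK (t + 1)).2], by linarith [h0.2, (hK (t + 1)).1]⟩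
  have h := ((hbd.div_const (p (W ω) 0 - p (W ω) 1)).const_add (share (p (W ω)))).mul_const
    (lat 0 - lat 1) |>.const_add (lat 1)
  simpa using h

theorem IsPopulation.tendsto_ineql (hκ : G.IsStationaryKernel p κ B)
    (hpop : G.IsPopulation μ (G.weightLaw ⊗ₘ κ) W K₀ P U)
    (hp : ∀ᵐ w ∂G.weightLaw, p w 1 < p w 0) {A : ℕ → Ω → Option (Fin 2)}
    (hAm : ∀ t r, MeasurableSet {ω | A t ω = some r})
    (hA : ∀ t, A t =ᵐ[μ] G.play p W K₀ P U t) {lat : Fin 2 → ℝ} (h0 : ∀ r, 0 ≤ lat r)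
    (hlat : ∀ t r, G.l r (agg μ W (A t) r) = lat r) :
    Tendsto (G.ineql μ W A) atTop (𝓝 √(variance
      (fun w => (lat 1 + share (p w) * (lat 0 - lat 1)) / w) G.weightLaw)) := by
  have hlimm : Measurable fun w => (lat 1 + share (p w) * (lat 0 - lat 1)) / w :=
    (((measurable_share.comp hκ.measurable_prices).mul_const _).const_add _).div measurable_id
  have hvar : variance (fun w => (lat 1 + share (p w) * (lat 0 - lat 1)) / w) G.weightLaw =
      variance (fun ω => (lat 1 + share (p (W ω)) * (lat 0 - lat 1)) / W ω) μ := by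
    conv_lhs => rw [← hpop.map_weight hκ]
    exact variance_map hlimm.aemeasurable hpop.measurable_W.aemeasurable
  rw [hvar]
  refine (Real.continuous_sqrt.tendsto _).comp
    (tendsto_variance_of_ae_bounded (B := (lat 0 + lat 1) / G.wmin) (fun t => ?_) (fun t => ?_) ?_)
  · exact ((measurable_avgLatency hAm t).div
      hpop.measurable_W).aestronglyMeasurable
  · filter_upwards [hpop.ae_weight hκ G.weight_mem] with ω hω
    rw [abs_div, abs_of_pos (G.wmin_pos.trans_le hω.1)]
    exact div_le_div₀ (add_nonneg (h0 0) (h0 1)) (abs_avgLatency_le h0 hlat t ω) G.wmin_pos hω.1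
  · filter_upwards [hpop.ae_tendsto_avgLatency hκ hp hA hlat] with ω hω using hω.div_const _

end CongestionGame

namespace CongestionGame

variable {G : CongestionGame} {wstar : Fin 2 → ℝ} {LC θ δ : ℝ} {p : ℝ → Fin 2 → ℝ}

/-! ### Distance of the stationary state from the design -/

theorem stationaryAgg_mem_Icc (hp : Measurable p)
    (hr : ∀ᵐ w ∂G.weightLaw, G.RealizesDesign wstar θ δ (p w) w) :
    G.stationaryAgg p ∈ Set.Icc 0 G.Pgo := by
  have hW := mean_weight_pos (G := G)
  have hmem : ∀ᵐ w ∂G.weightLaw, share (p w) ∈ Set.Icc 0 1 := by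
    filter_upwards [hr] with w h using share_mem_Icc h.first_nonneg h.second_nonpos h.lt
  have hP := G.Pgo_pos.le
  have hint : Integrable (fun w => G.Pgo * share (p w) * w) G.weightLaw :=
    integrable_mul_weight ((measurable_share.comp hp).const_mul _).aestronglyMeasurable
      (B := G.Pgo) (by
        filter_upwards [hmem] with w hw
        rw [abs_of_nonneg (mul_nonneg hP hw.1)]
        exact mul_le_of_le_one_right hP hw.2)
  refine ⟨div_nonneg (integral_nonneg_of_ae ?_) hW.le, (div_le_iff₀ hW).mpr ?_⟩
  · filter_upwards [hmem, ae_weight_pos] with w hw h0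
    exact mul_nonneg (mul_nonneg hP hw.1) h0.le
  · rw [← integral_const_mul]
    refine integral_mono_ae hint (integrable_weight.const_mul _) ?_
    filter_upwards [hmem, ae_weight_pos] with w hw h0
    exact mul_le_mul_of_nonneg_right (mul_le_of_le_one_right hP hw.2) h0.le

theorem abs_stationaryAgg_sub_le (hθ : G.IsDesignSolution wstar θ) (hp : Measurable p)
    (hr : ∀ᵐ w ∂G.weightLaw, G.RealizesDesign wstar θ δ (p w) w) :
    |G.stationaryAgg p - wstar 0| ≤ G.Pgo * δ := by
  have hW := mean_weight_pos (G := G)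
  have hdm : AEStronglyMeasurable (fun w => G.Pgo * share (p w) - G.n₁ wstar θ w) G.weightLaw :=
    (((measurable_share.comp hp).const_mul _).sub measurable_n₁).aestronglyMeasurable
  have hdb : ∀ᵐ w ∂G.weightLaw, |G.Pgo * share (p w) - G.n₁ wstar θ w| ≤ G.Pgo * δ := by
    filter_upwards [hr] with w h using h.abs_share_sub_le
  have hdi := integrable_mul_weight hdm hdb
  have hsplit : ∫ w, G.Pgo * share (p w) * w ∂G.weightLaw =
      ∫ w, (G.Pgo * share (p w) - G.n₁ wstar θ w) * w ∂G.weightLaw +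
        wstar 0 * ∫ w, w ∂G.weightLaw := by
    rw [hθ.2, ← integral_add hdi integrable_n₁_mul]
    exact integral_congr_ae (Eventually.of_forall fun w => by ring)
  rw [stationaryAgg, hsplit, add_div, mul_div_cancel_right₀ _ hW.ne', add_sub_cancel_right,
    abs_div, abs_of_pos hW, div_le_iff₀ hW, ← integral_const_mul]
  refine abs_integral_le_integral_abs.trans (integral_mono_ae hdi.abs
    (integrable_weight.const_mul _) ?_)
  filter_upwards [hdb, ae_weight_pos] with w h h0
  rw [abs_mul, abs_of_pos h0]
  exact mul_le_mul_of_nonneg_right h h0.le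

theorem stationaryAgg_eq_of_eq_Pgo (hθ : G.IsDesignSolution wstar θ) (h0 : wstar 0 = G.Pgo)
    (hr : ∀ᵐ w ∂G.weightLaw, G.RealizesDesign wstar θ δ (p w) w) :
    G.stationaryAgg p = G.Pgo := by
  have : ∫ w, G.Pgo * share (p w) * w ∂G.weightLaw = G.Pgo * ∫ w, w ∂G.weightLaw := by
    rw [← integral_const_mul]
    refine integral_congr_ae ?_
    filter_upwards [hr, hθ.ae_n₁_eq h0] with w h hn
    rw [h.share_eq_one hn, mul_one]
  rw [stationaryAgg, this, mul_div_cancel_right₀ _ mean_weight_pos.ne']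

/-- A Lipschitz constant, relative to the precision `δ`, of the latency of resource `r` near the
optimum. It comes from the Lipschitz constant of the cost, hence the division; it is `0` if the
resource is not used at the optimum. -/
def latencyConst (G : CongestionGame) (wstar : Fin 2 → ℝ) (LC : ℝ) (r : Fin 2) : ℝ :=
  (LC + G.l r G.Pgo) / wstar r * G.Pgo

theorem latencyConst_nonneg (hopt : G.IsOptimum wstar) (hLC : 0 < LC) (r : Fin 2) :
    0 ≤ latencyConst G wstar LC r :=
  mul_nonneg (div_nonneg (add_nonneg hLC.le (G.l_nonneg r _ ⟨G.Pgo_pos.le, le_rfl⟩))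
    (hopt.1.1 r)) G.Pgo_pos.le

theorem abs_latency_stationary_sub_le (hopt : G.IsOptimum wstar) (hpos : 0 < wstar 0)
    (hLC : 0 < LC) (hC : G.CostLipschitz LC) {w : Fin 2 → ℝ} (hw : w ∈ G.aggregates)
    (hclose : |w 0 - wstar 0| ≤ G.Pgo * δ) (hexact : wstar 0 = G.Pgo → w 0 = G.Pgo) (r : Fin 2) :
    |G.l r (w r) - G.l r (wstar r)| ≤ latencyConst G wstar LC r * δ := by
  have hs := hopt.add_eq
  have hs' : w 0 + w 1 = G.Pgo := by simpa [Fin.sum_univ_two] using hw.2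
  have h0 := hw.1 0
  have h1 := hw.1 1
  have hmem : w r ∈ Set.Icc 0 G.Pgo := by
    obtain rfl | rfl : r = 0 ∨ r = 1 := by omega
    · exact ⟨h0, by linarith⟩
    · exact ⟨h1, by linarith⟩
  have hclose' : |w r - wstar r| ≤ G.Pgo * δ := by
    obtain rfl | rfl : r = 0 ∨ r = 1 := by omega
    · exact hclose
    · rwa [show w 1 - wstar 1 = -(w 0 - wstar 0) by linarith, abs_neg]
  rcases (hopt.1.1 r).eq_or_lt with hr | hr
  · have hr1 : r = 1 := by
      by_contra h
      obtain rfl : r = 0 := by omega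
      linarith
    subst hr1
    have : w 1 = wstar 1 := by linarith [hexact (by linarith)]
    simp [this, latencyConst, ← hr]
  · refine (hC.abs_latency_sub_le r hmem (hopt.mem_Icc r) hr).trans ?_
    rw [latencyConst, mul_assoc]
    exact mul_le_mul_of_nonneg_left hclose' (div_nonneg (add_nonneg hLC.le
      (G.l_nonneg r _ ⟨G.Pgo_pos.le, le_rfl⟩)) hr.le)

theorem memLp_div_weight {f : ℝ → ℝ} (hf : Measurable f) {b : ℝ}
    (hb : ∀ᵐ w ∂G.weightLaw, |f w| ≤ b) : MemLp (fun w => f w / w) 2 G.weightLaw := by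
  refine MemLp.of_bound (hf.div measurable_id).aestronglyMeasurable (b / G.wmin) ?_
  filter_upwards [hb, G.weight_mem] with w h hw
  rw [Real.norm_eq_abs, abs_div, abs_of_pos (G.wmin_pos.trans_le hw.1)]
  exact div_le_div₀ ((abs_nonneg _).trans h) h G.wmin_pos hw.1

theorem abs_mix_le {a b s : ℝ} (ha : 0 ≤ a) (hb : 0 ≤ b) (hs : s ∈ Set.Icc (0 : ℝ) 1) :
    |b + s * (a - b)| ≤ a + b := by
  have h1 := mul_nonneg hs.1 ha
  have h2 := mul_nonneg (sub_nonneg.mpr hs.2) hb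
  have h3 := mul_le_of_le_one_left ha hs.2
  have h4 := mul_nonneg hs.1 hb
  rw [abs_of_nonneg (by linarith)]
  linarith

theorem designLatency_eq (w : ℝ) : G.designLatency wstar θ w =
    G.l 1 (wstar 1) + G.n₁ wstar θ w / G.Pgo * (G.l 0 (wstar 0) - G.l 1 (wstar 1)) := by
  have := G.Pgo_pos
  rw [designLatency, n₂]
  field_simp
  ring

theorem abs_limit_ineql_sub_designIneql_le (hopt : G.IsOptimum wstar)
    (hlat : G.l 0 (wstar 0) < G.l 1 (wstar 1)) (hLC : 0 < LC) (hδ : 0 < δ) (hp : Measurable p)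
    (hr : ∀ᵐ w ∂G.weightLaw, G.RealizesDesign wstar θ δ (p w) w) {lat : Fin 2 → ℝ}
    (hlat0 : ∀ r, 0 ≤ lat r)
    (hclose : ∀ r, |lat r - G.l r (wstar r)| ≤ latencyConst G wstar LC r * δ) :
    |√(variance (fun w => (lat 1 + share (p w) * (lat 0 - lat 1)) / w) G.weightLaw) -
      G.designIneql wstar θ| ≤ (G.l 1 (wstar 1) - G.l 0 (wstar 0) + latencyConst G wstar LC 0 +
        latencyConst G wstar LC 1) * δ / G.wmin := by
  have hP := G.Pgo_pos
  have hc := latencyConst_nonneg hopt hLC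
  have hopt0 : ∀ r, 0 ≤ G.l r (wstar r) := fun r => G.l_nonneg r _ (hopt.mem_Icc r)
  have hnum : 0 ≤ (G.l 1 (wstar 1) - G.l 0 (wstar 0) + latencyConst G wstar LC 0 +
        latencyConst G wstar LC 1) * δ :=
    mul_nonneg (by linarith [hc 0, hc 1]) hδ.le
  have hmem : ∀ᵐ w ∂G.weightLaw, share (p w) ∈ Set.Icc 0 1 := by
    filter_upwards [hr] with w h using share_mem_Icc h.first_nonneg h.second_nonpos h.lt
  refine abs_sqrt_variance_sub_le (memLp_div_weight
    (((measurable_share.comp hp).mul_const _).const_add _) (b := lat 0 + lat 1) ?_)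
    (memLp_div_weight (b := G.l 0 (wstar 0) + G.l 1 (wstar 1)) ?_ ?_)
    (div_nonneg hnum G.wmin_pos.le) ?_
  · filter_upwards [hmem] with w hw using abs_mix_le (hlat0 0) (hlat0 1) hw
  · simp_rw [funext (designLatency_eq (G := G) (wstar := wstar) (θ := θ))]
    exact ((measurable_n₁.div_const _).mul_const _).const_add _
  · refine Eventually.of_forall fun w => ?_
    have hn := n₁_mem_Icc (G := G) (wstar := wstar) (θ := θ) w
    rw [designLatency_eq]
    exact abs_mix_le (hopt0 0) (hopt0 1) ⟨div_nonneg hn.1 hP.le, (div_le_one hP).mpr hn.2⟩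
  · filter_upwards [hmem, hr, G.weight_mem] with w hs h hw
    rw [← sub_div, abs_div, abs_of_pos (G.wmin_pos.trans_le hw.1)]
    refine div_le_div₀ hnum ?_ G.wmin_pos hw.1
    have hshare : |share (p w) - G.n₁ wstar θ w / G.Pgo| ≤ δ := by
      have h' := h.abs_share_sub_le
      rw [show G.Pgo * share (p w) - G.n₁ wstar θ w =
        G.Pgo * (share (p w) - G.n₁ wstar θ w / G.Pgo) by field_simp, abs_mul, abs_of_pos hP] at h'
      exact le_of_mul_le_mul_left h' hP
    rw [designLatency_eq]
    calc |lat 1 + share (p w) * (lat 0 - lat 1) - (G.l 1 (wstar 1) +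
          G.n₁ wstar θ w / G.Pgo * (G.l 0 (wstar 0) - G.l 1 (wstar 1)))|
        = |(share (p w) - G.n₁ wstar θ w / G.Pgo) * (G.l 0 (wstar 0) - G.l 1 (wstar 1)) +
            share (p w) * (lat 0 - G.l 0 (wstar 0)) +
            (1 - share (p w)) * (lat 1 - G.l 1 (wstar 1))| := by congr 1; ring
      _ ≤ δ * (G.l 1 (wstar 1) - G.l 0 (wstar 0)) + 1 * (latencyConst G wstar LC 0 * δ) +
            1 * (latencyConst G wstar LC 1 * δ) := by
          refine (abs_add_three _ _ _).trans (add_le_add_three ?_ ?_ ?_) <;> rw [abs_mul]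
          · rw [abs_sub_comm (G.l 0 _), abs_of_pos (sub_pos.mpr hlat)]
            exact mul_le_mul_of_nonneg_right hshare (sub_nonneg.mpr hlat.le)
          · rw [abs_of_nonneg hs.1]
            exact mul_le_mul hs.2 (hclose 0) (abs_nonneg _) zero_le_one
          · rw [abs_of_nonneg (sub_nonneg.mpr hs.2)]
            exact mul_le_mul (by linarith [hs.1]) (hclose 1) (abs_nonneg _) zero_le_one
      _ = _ := by ring

theorem D_pos (hopt : G.IsOptimum wstar) (hpos : 0 < G.cost wstar)
    (hlat : G.l 0 (wstar 0) < G.l 1 (wstar 1)) (hLC : 0 < LC) : 0 < G.D wstar LC := by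
  have hP := G.Pgo_pos
  have hm := G.wmin_pos
  have hl0 : 0 ≤ G.l 0 (wstar 0) := G.l_nonneg 0 _ (hopt.mem_Icc 0)
  have hl1 : 0 < G.l 1 (wstar 1) := hl0.trans_lt hlat
  have hgap : 0 < G.l 1 (wstar 1) - G.l 0 (wstar 0) := sub_pos.mpr hlat
  have hmax : 0 < G.wmax := by
    obtain ⟨w, hw⟩ := G.weight_mem.exists
    linarith [hw.1, hw.2]
  have hinv : 0 < ∫ w, 1 / w ∂G.weightLaw := by
    refine (one_div_pos.mpr hmax).trans_le ?_
    calc 1 / G.wmax = ∫ _, 1 / G.wmax ∂G.weightLaw := by simp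
      _ ≤ _ := by
        refine integral_mono_ae (integrable_const _) ((memLp_div_weight (f := fun _ => 1)
          measurable_const (b := 1) (by simp)).integrable (by norm_num)) ?_
        filter_upwards [G.weight_mem] with w hw
        exact one_div_le_one_div_of_le (hm.trans_le hw.1) hw.2
  have hinv2 : 0 ≤ ∫ w, 1 / w ^ 2 ∂G.weightLaw := integral_nonneg fun w => by positivity
  have hD₁ : 0 < G.D₁ wstar := by
    unfold D₁
    positivity
  have hD₂ : 0 ≤ G.D₂ wstar := by
    have : 0 ≤ 2 * G.l 1 (wstar 1) - G.l 0 (wstar 0) := by linarith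
    unfold D₂
    positivity
  unfold D
  positivity

end CongestionGame

end

theorem mainTheorem3 (G : CongestionGame) (wstar : Fin 2 → ℝ) (LC θ : ℝ)
    (hopt : G.IsOptimum wstar) (hpos : 0 < G.cost wstar)
    (hlat : G.l 0 (wstar 0) < G.l 1 (wstar 1))
    (hLC : 0 < LC) (hC : G.CostLipschitz LC)
    (hθ : G.IsDesignSolution wstar θ) :
    ∃ ε₀ : ℝ, 0 < ε₀ ∧ ∀ ε : ℝ, 0 < ε → ε < ε₀ →
      ∀ (S : ℝ) (q : ℕ → ℚ), 0 < S →
        CongestionGame.IsRatSeq (G.step wstar LC ε) q →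
        ∃ init : MeasureTheory.Measure (ℝ × ℝ),
          MeasureTheory.IsProbabilityMeasure init ∧
          init.map Prod.fst = G.weightLaw ∧
          (∀ᵐ z ∂init, 0 ≤ z.2) ∧
          ∀ {Ω : Type*} [MeasurableSpace Ω] (μ : MeasureTheory.Measure Ω)
            [MeasureTheory.IsProbabilityMeasure μ] (W K₀ : Ω → ℝ) (P : ℕ → Ω → Bool)
            (U : ℕ → Ω → ℝ), G.IsPopulation μ init W K₀ P U →
            (∃ A : ℕ → Ω → Option (Fin 2),
              G.IsNashTrajectory μ (G.prices wstar θ (G.step wstar LC ε) S q) W K₀ P U A ∧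
              G.FirstFaster μ W A) ∧
            ∀ A : ℕ → Ω → Option (Fin 2),
              G.IsNashTrajectory μ (G.prices wstar θ (G.step wstar LC ε) S q) W K₀ P U A →
              G.FirstFaster μ W A →
              (∃ a : ℝ, Filter.Tendsto (G.poa μ W wstar A) Filter.atTop (nhds a) ∧
                a ≤ 1 + ε) ∧
              (∃ b : ℝ, Filter.Tendsto (G.ineql μ W A) Filter.atTop (nhds b) ∧
                |b - G.designIneql wstar θ| < Real.sqrt (G.D wstar LC * ε)) := by
  open CongestionGame in
  have hP := G.Pgo_pos
  have hw0 := hopt.first_pos hlat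
  have hD := D_pos hopt hpos hlat hLC
  have hc := latencyConst_nonneg hopt hLC
  have hgap : 0 < G.l 1 (wstar 1) - G.l 0 (wstar 0) := sub_pos.mpr hlat
  obtain ⟨c, hcdef⟩ : ∃ c, c = latencyConst G wstar LC 0 + latencyConst G wstar LC 1 := ⟨_, rfl⟩
  obtain ⟨ρ, hρdef⟩ : ∃ ρ, ρ = G.Pgo * G.cost wstar / LC := ⟨_, rfl⟩
  have hc0 : 0 ≤ c := hcdef ▸ add_nonneg (hc 0) (hc 1)
  have hρ : 0 < ρ := by rw [hρdef]; positivity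
  obtain ⟨b, hbdef⟩ : ∃ b, b = (G.l 1 (wstar 1) - G.l 0 (wstar 0) + c) * ρ / G.wmin := ⟨_, rfl⟩
  have hb : 0 < b := by
    have := G.wmin_pos
    rw [hbdef]
    positivity
  -- the first bound keeps resource `0` faster; the second makes the inequality gap, which is of
  -- order `ε`, smaller than the allowed one, which is of order `√ε`
  refine ⟨min ((G.l 1 (wstar 1) - G.l 0 (wstar 0)) / ((c + 1) * ρ)) (G.D wstar LC / b ^ 2),
    by positivity, fun ε hε hεlt S q hS hq => ?_⟩
  have hε1 : ε * ((c + 1) * ρ) < G.l 1 (wstar 1) - G.l 0 (wstar 0) :=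
    (lt_div_iff₀ (by positivity)).mp (hεlt.trans_le (min_le_left _ _))
  have hε2 : ε * b ^ 2 < G.D wstar LC :=
    (lt_div_iff₀ (by positivity)).mp (hεlt.trans_le (min_le_right _ _))
  have hstep : G.step wstar LC ε = ε * ρ := by
    rw [hρdef, step]
    ring
  have hδ : 0 < G.step wstar LC ε := by
    rw [hstep]
    positivity
  obtain ⟨κ, B, hκ⟩ := exists_isStationaryKernel (G := G) (wstar := wstar) (θ := θ) hδ hS hq
  have hmarkov := hκ.markov
  have hreal := ae_realizesDesign_prices hopt hw0 hθ hδ hS hq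
  have hp1 : ∀ᵐ w ∂G.weightLaw, G.prices wstar θ (G.step wstar LC ε) S q w 1 ≤ 0 ∧
      G.prices wstar θ (G.step wstar LC ε) S q w 1 <
        G.prices wstar θ (G.step wstar LC ε) S q w 0 := by
    filter_upwards [hreal] with w h using ⟨h.second_nonpos, h.lt⟩
  have hp01 := hp1.mono fun w h => h.2
  -- the stationary aggregate
  obtain ⟨a, ha⟩ : ∃ a, a = G.stationaryAgg (G.prices wstar θ (G.step wstar LC ε) S q) :=
    ⟨_, rfl⟩
  have hamem : a ∈ Set.Icc 0 G.Pgo := ha ▸ stationaryAgg_mem_Icc hκ.measurable_prices hreal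
  have haclose : |a - wstar 0| ≤ G.Pgo * G.step wstar LC ε :=
    ha ▸ abs_stationaryAgg_sub_le hθ hκ.measurable_prices hreal
  have haexact : wstar 0 = G.Pgo → a = G.Pgo := fun h =>
    ha ▸ stationaryAgg_eq_of_eq_Pgo hθ h hreal
  have hagg : ![a, G.Pgo - a] ∈ G.aggregates := by
    refine ⟨fun r => ?_, by simp⟩
    fin_cases r
    · exact hamem.1
    · exact sub_nonneg.mpr hamem.2
  have hlclose := abs_latency_stationary_sub_le hopt hw0 hLC hC hagg haclose haexact
  have hlnonneg : ∀ r, 0 ≤ G.l r (![a, G.Pgo - a] r) := fun r => by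
    refine G.l_nonneg r _ ?_
    fin_cases r
    · exact hamem
    · exact ⟨sub_nonneg.mpr hamem.2, sub_le_self _ hamem.1⟩
  have hfast : G.l 0 (![a, G.Pgo - a] 0) < G.l 1 (![a, G.Pgo - a] 1) := by
    have h0 := (abs_le.mp (hlclose 0)).2
    have h1 := (abs_le.mp (hlclose 1)).1
    have h2 : (latencyConst G wstar LC 0 + latencyConst G wstar LC 1) * G.step wstar LC ε <
        G.l 1 (wstar 1) - G.l 0 (wstar 0) := by
      rw [← hcdef, hstep]
      refine lt_of_le_of_lt ?_ hε1
      nlinarith [mul_pos hε hρ]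
    linarith
  have hcost : G.cost ![a, G.Pgo - a] / G.cost wstar ≤ 1 + ε := by
    rw [div_le_iff₀ hpos]
    have h1 := hC.cost_le hopt.1 hagg
    have h2 : LC * |a - wstar 0| ≤ ε * G.cost wstar := by
      calc LC * |a - wstar 0| ≤ LC * (G.Pgo * G.step wstar LC ε) :=
            mul_le_mul_of_nonneg_left haclose hLC.le
        _ = G.Pgo ^ 2 * (ε * G.cost wstar) := by
            rw [step]
            field_simp
        _ ≤ ε * G.cost wstar :=
            mul_le_of_le_one_left (by positivity) (pow_le_one₀ hP.le G.Pgo_le_one)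
    simp only [Matrix.cons_val_zero] at h1
    linarith
  have hineq := abs_limit_ineql_sub_designIneql_le hopt hlat hLC hδ hκ.measurable_prices hreal
    hlnonneg hlclose
  refine ⟨G.weightLaw ⊗ₘ κ, inferInstance, Measure.fst_compProd _ _, ?_, ?_⟩
  · exact (Measure.ae_compProd_iff (measurableSet_le measurable_const measurable_snd)).mpr
      (Eventually.of_forall fun w => (hκ.bounded w).mono fun k hk => hk.1)
  intro Ω _ μ _ W K₀ P U hpop
  have hplay : ∀ t, agg μ W (G.play (G.prices wstar θ (G.step wstar LC ε) S q) W K₀ P U t) =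
      ![a, G.Pgo - a] := fun t => by
    have h0 := hpop.agg_play_zero hκ hp01 t
    have h1 := hpop.agg_play_add hκ t
    funext r
    fin_cases r
    · exact h0.trans ha.symm
    · change agg μ W _ 1 = G.Pgo - a
      rw [ha, ← h0]
      linarith
  have hplayfast : G.FirstFaster μ W
      (G.play (G.prices wstar θ (G.step wstar LC ε) S q) W K₀ P U) := fun t => by
    rw [hplay t]
    exact hfast
  refine ⟨⟨_, hpop.isNashTrajectory_play hκ hp1 hplayfast, hplayfast⟩, fun A hA hAfast => ?_⟩
  have hAplay := hpop.ae_eq_play hκ hp1 hA hAfast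
  have hAagg : ∀ t, agg μ W (A t) = ![a, G.Pgo - a] := fun t =>
    (agg_congr (hAplay t)).trans (hplay t)
  refine ⟨⟨_, tendsto_const_nhds.congr fun t => ?_, hcost⟩, ⟨_, hpop.tendsto_ineql hκ hp01
    (fun t => (hA t).1) hAplay hlnonneg (fun t r => by rw [hAagg t]), hineq.trans_lt ?_⟩⟩
  · rw [poa, hAagg t]
  · rw [Real.lt_sqrt (div_nonneg (mul_nonneg (by linarith [hc 0, hc 1]) hδ.le) G.wmin_pos.le)]
    have : (G.l 1 (wstar 1) - G.l 0 (wstar 0) + latencyConst G wstar LC 0 +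
        latencyConst G wstar LC 1) * G.step wstar LC ε / G.wmin = ε * b := by
      rw [hbdef, hcdef, hstep]
      ring
    rw [this]
    nlinarith [mul_lt_mul_of_pos_left hε2 hε]
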